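/- Let $d,N\ge 1$ be integers. For $k\ge 1$ let $\mathcal S_s(\mathbb R^{dk})$ be the space of complex-valued Schwartz functions $f(x_1,\dots,x_k)$, $x_i\in\mathbb R^d$, that are invariant under all permutations of $x_1,\dots,x_k$, with the subspace topology of $\mathcal S(\mathbb R^{dk})$, and let $\mathcal S_s'(\mathbb R^{dk})$ be its strong dual, in which $\mathcal S_s(\mathbb R^{dk})$ is included by $f\mapsto (g\mapsto\int fg)$. Let $\langle f,g\rangle=\int\overline f\,g$. Let $\mathfrak g_k$ be the real vector space of all continuous linear maps $A:\mathcal S_s(\mathbb R^{dk})\to\mathcal S_s(\mathbb R^{dk})$ that are skew-adjoint, i.e. $\langle Af,g\rangle=-\langle f,Ag\rangle$ for all $f,g\in \mathcal S_s(\mathbb R^{dk})$, with the subspace topology of $\mathcal L(\mathcal S_s(\mathbb R^{dk}),\mathcal S_s'(\mathbb R^{dk}))$, the latter with the topology of uniform convergence on bounded sets. Put $[A,B]_{\mathfrak g_k}=k(AB-BA)$. For $1\le k\le N$, $A\in\mathfrak g_k$ and a $k$-tuple $\underline j=(j_1,\dots,j_k)$ of distinct elements of $\{1,\dots,N\}$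 let $A_{\underline j}$ be the operator on $\mathcal S_s(\mathbb R^{dN})$ that acts as $A$ in the variables $(x_{j_1},\dots,x_{j_k})$ and as the identity in the other variables (for $\underline j=(1,\dots,k)$ it is $A\otimes \mathrm{Id}$), that is, $$(A_{\underline j}f)(x)=\bigl(A f_{\underline j,x}\bigr)(x_{j_1},\dots,x_{j_k}),$$ where $f_{\underline j,x}(y_1,\dots,y_k)$ is the value of $f$ at the point obtained from $x$ by replacing $x_{j_i}$ by $y_i$ for $i=1,\dots,k$. Put $$\epsilon_{k,N}(A)=\frac1{k!\binom Nk}\sum_{\underline j}A_{\underline j},$$ the sum being over all such tuples. Let $\mathfrak G_N=\bigoplus_{k=1}^N\mathfrak g_k$ be the locally convex direct sum. Then the following hold. 1. For $1\le k\le N$, $\epsilon_{k,N}$ is a well-defined injective continuous linear map $\mathfrak g_k\to\mathfrak g_N$. 2. For $1\le \ell,j\le N$, $$[\epsilon_{\ell,N}(\mathfrak g_\ell),\epsilon_{j,N}(\mathfrak g_j)]_{\mathfrak g_N}\subset\epsilon_{m,N}(\mathfrak g_m),\qquad m=\min\{\ell+j-1,N\}.$$ 3. Consequently the bracket $$[A,B]_{\mathfrak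 G_N}^{(k)}=\sum_{\substack{1\le\ell,j\le N\\ \min\{\ell+j-1,N\}=k}}\epsilon_{k,N}^{-1}\bigl([\epsilon_{\ell,N}(A^{(\ell)}),\epsilon_{j,N}(B^{(j)})]_{\mathfrak g_N}\bigr),\qquad 1\le k\le N,$$ is well defined for $A=(A^{(k)})_{k\le N}$ and $B=(B^{(k)})_{k\le N}$ in $\mathfrak G_N$, and $(\mathfrak G_N,[\cdot,\cdot]_{\mathfrak G_N})$ is a Lie algebra in the following sense: $\mathfrak G_N$ is a Hausdorff locally convex real vector space, and the bracket $\mathfrak G_N\times\mathfrak G_N\to\mathfrak G_N$ is separately continuous, bilinear, satisfies $[A,A]_{\mathfrak G_N}=0$ for all $A$, and satisfies the Jacobi identity. -/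

import Mathlib

open scoped SchwartzMap

noncomputable section

namespace Hierarchy

/-- The configuration space `(ℝ^d)^k` of `k` particles in `ℝ^d`.  Its norm is equivalent to the
Euclidean norm of `ℝ^{dk}` and its volume is the Lebesgue measure of `ℝ^{dk}`. -/
abbrev Config (d k : ℕ) : Type := Fin k → EuclideanSpace ℝ (Fin d)

instance (d k : ℕ) :
    (MeasureTheory.volume : MeasureTheory.Measure (Config d k)).IsAddHaarMeasure :=
  inferInstanceAs (MeasureTheory.Measure.pi fun _ : Fin k =>
    (MeasureTheory.volume : MeasureTheory.Measure (EuclideanSpace ℝ (Fin d)))).IsAddHaarMeasure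

/-- The bosonic (symmetric) Schwartz functions of `k` particles, a subspace of the Schwartz space
of `(ℝ^d)^k` and carrying its topology. -/
def bosonic (d k : ℕ) : Submodule ℂ 𝓢(Config d k, ℂ) where
  carrier := {f | ∀ (σ : Equiv.Perm (Fin k)) (x : Config d k), f (x ∘ σ) = f x}
  zero_mem' := fun _ _ => by simp
  add_mem' := fun {f g} hf hg σ x => by
    rw [add_apply, add_apply, hf σ x, hg σ x]
  smul_mem' := fun c f hf σ x => by
    rw [smul_apply, smul_apply, hf σ x]

/-- The bosonic Schwartz space `𝓢_s((ℝ^d)^k)`. -/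
abbrev Bosonic (d k : ℕ) : Type := ↥(bosonic d k)

/-- The space `𝓢_s'((ℝ^d)^k)` of bosonic tempered distributions, that is, the dual of the bosonic
Schwartz space with the strong dual topology (uniform convergence on bounded sets, which is the
topology that Mathlib puts on a space of continuous linear maps). -/
abbrev BosonicDual (d k : ℕ) : Type := Bosonic d k →L[ℂ] ℂ

/-- The `L²` inner product `⟨f, g⟩ = ∫ conj f · g`, linear in the second entry. -/
def l2Inner {d k : ℕ} (f g : Bosonic d k) : ℂ :=
  ∫ x, (starRingEnd ℂ) (f.1 x) * g.1 x

/-- A bosonic Schwartz function as an element of `L²`. -/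
def toL2 (d k : ℕ) : Bosonic d k →L[ℂ]
    MeasureTheory.Lp ℂ 2 (MeasureTheory.volume : MeasureTheory.Measure (Config d k)) :=
  (SchwartzMap.toLpCLM ℂ ℂ 2 MeasureTheory.volume).comp (bosonic d k).subtypeL

theorem coeFn_toL2 {d k : ℕ} (f : Bosonic d k) :
    toL2 d k f =ᵐ[MeasureTheory.volume] f.1 :=
  f.1.coeFn_toLp 2 MeasureTheory.volume

/-- The inclusion of the bosonic Schwartz space into its dual, `f ↦ (g ↦ ∫ f · g)`. -/
def toDual (d k : ℕ) : Bosonic d k →L[ℂ] BosonicDual d k :=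
  (ContinuousLinearMap.precomp ℂ (toL2 d k)).comp
    (((ContinuousLinearMap.mul ℂ ℂ).lpPairing MeasureTheory.volume 2 2).comp (toL2 d k))

theorem toDual_apply {d k : ℕ} (f g : Bosonic d k) :
    toDual d k f g = ∫ x, f.1 x * g.1 x := by
  have h : toDual d k f g = (ContinuousLinearMap.mul ℂ ℂ).lpPairing MeasureTheory.volume 2 2
    (toL2 d k f) (toL2 d k g) := rfl
  rw [h, ContinuousLinearMap.lpPairing_eq_integral]
  apply MeasureTheory.integral_congr_ae
  filter_upwards [coeFn_toL2 f, coeFn_toL2 g] with x hf hg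
  rw [hf, hg, ContinuousLinearMap.mul_apply']

theorem l2Inner_eq {d k : ℕ} (f g : Bosonic d k) :
    l2Inner f g = inner ℂ (toL2 d k f) (toL2 d k g) := by
  rw [MeasureTheory.L2.inner_def, l2Inner]
  apply MeasureTheory.integral_congr_ae
  filter_upwards [coeFn_toL2 f, coeFn_toL2 g] with x hf hg
  rw [hf, hg, RCLike.inner_apply, mul_comm]

theorem l2Inner_add_left {d k : ℕ} (f f' g : Bosonic d k) :
    l2Inner (f + f') g = l2Inner f g + l2Inner f' g := by
  simp only [l2Inner_eq, map_add, inner_add_left]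

theorem l2Inner_add_right {d k : ℕ} (f g g' : Bosonic d k) :
    l2Inner f (g + g') = l2Inner f g + l2Inner f g' := by
  simp only [l2Inner_eq, map_add, inner_add_right]

theorem l2Inner_smul_left {d k : ℕ} (c : ℂ) (f g : Bosonic d k) :
    l2Inner (c • f) g = (starRingEnd ℂ) c * l2Inner f g := by
  simp only [l2Inner_eq, map_smul, inner_smul_left]

theorem l2Inner_smul_right {d k : ℕ} (c : ℂ) (f g : Bosonic d k) :
    l2Inner f (c • g) = c * l2Inner f g := by
  simp only [l2Inner_eq, map_smul, inner_smul_right]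

theorem l2Inner_real_smul_left {d k : ℕ} (c : ℝ) (f g : Bosonic d k) :
    l2Inner (c • f) g = c * l2Inner f g := by
  rw [← Complex.coe_smul, l2Inner_smul_left, Complex.conj_ofReal]

theorem l2Inner_real_smul_right {d k : ℕ} (c : ℝ) (f g : Bosonic d k) :
    l2Inner f (c • g) = c * l2Inner f g := by
  rw [← Complex.coe_smul, l2Inner_smul_right]

/-- The real vector space of skew-adjoint operators: those continuous linear maps `A` of the
bosonic Schwartz space into itself with `A* = -A`, that is, `⟨A f, g⟩ = -⟨f, A g⟩` for all test
functions. -/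
def skewAdjoints (d k : ℕ) : Submodule ℝ (Bosonic d k →L[ℂ] Bosonic d k) where
  carrier := {A | ∀ f g : Bosonic d k, l2Inner (A f) g = -l2Inner f (A g)}
  zero_mem' := fun f g => by
    simp [l2Inner]
  add_mem' := fun {A B} hA hB f g => by
    rw [add_apply, add_apply, l2Inner_add_left,
      l2Inner_add_right, hA f g, hB f g]
    ring
  smul_mem' := fun c A hA f g => by
    change l2Inner (c • A f) g = -l2Inner f (c • A g)
    rw [l2Inner_real_smul_left, l2Inner_real_smul_right, hA f g]
    ring

/-- The space `𝔤_k` of `k`-particle bosonic observables.  It is a type of its own since its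
topology is not the topology of bounded convergence of maps into the bosonic Schwartz space. -/
def Observable (d k : ℕ) : Type := ↥(skewAdjoints d k)

namespace Observable

instance (d k : ℕ) : AddCommGroup (Observable d k) :=
  inferInstanceAs (AddCommGroup ↥(skewAdjoints d k))

instance (d k : ℕ) : Module ℝ (Observable d k) :=
  inferInstanceAs (Module ℝ ↥(skewAdjoints d k))

/-- The operator on the bosonic Schwartz space underlying an observable. -/
def op {d k : ℕ} (A : Observable d k) : Bosonic d k →L[ℂ] Bosonic d k := A.val

theorem skew {d k : ℕ} (A : Observable d k) (f g : Bosonic d k) :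
    l2Inner (A.op f) g = -l2Inner f (A.op g) := A.property f g

/-- `𝔤_k` has the subspace topology of `L(𝓢_s, 𝓢_s')`, the latter with the topology of bounded
convergence. -/
instance (d k : ℕ) : TopologicalSpace (Observable d k) :=
  TopologicalSpace.induced
    (fun A => ((toDual d k).comp A.op : Bosonic d k →L[ℂ] BosonicDual d k)) inferInstance

/-- The Lie bracket `[A, B]_{𝔤_k} = k (A B - B A)`. -/
def lie {d k : ℕ} (A B : Observable d k) : Observable d k :=
  ⟨(k : ℝ) • (A.op.comp B.op - B.op.comp A.op), (skewAdjoints d k).smul_mem _ (fun f g => by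
    have h (u : Bosonic d k) : (A.op.comp B.op - B.op.comp A.op) u =
        A.op (B.op u) + (-1 : ℝ) • B.op (A.op u) := by
      rw [neg_one_smul, ← sub_eq_add_neg]
      rfl
    rw [h, h]
    simp only [l2Inner_add_left, l2Inner_add_right, l2Inner_real_smul_left,
      l2Inner_real_smul_right, skew, Complex.ofReal_neg, Complex.ofReal_one]
    ring)⟩

end Observable

/-- The map `y ↦ x` with the coordinates `j_1, …, j_k` of `x` replaced by `y_1, …, y_k`. -/
def insert {d k N : ℕ} (j : Fin k ↪ Fin N) (x : Config d N) (y : Config d k) : Config d N :=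
  Function.extend j y x

theorem insert_hasTemperateGrowth {d k N : ℕ} (j : Fin k ↪ Fin N) (x : Config d N) :
    (insert j x : Config d k → Config d N).HasTemperateGrowth := by
  classical
  let L : Config d k →L[ℝ] Config d N := ContinuousLinearMap.pi fun a =>
    if h : ∃ i, j i = a then ContinuousLinearMap.proj h.choose else 0
  have h : (insert j x : Config d k → Config d N) = fun y => L y + insert j x 0 := by
    funext y a
    simp only [insert, Function.extend, L, Pi.add_apply, ContinuousLinearMap.pi_apply]
    split_ifs <;> simp
  rw [h]
  exact L.hasTemperateGrowth.add (Function.HasTemperateGrowth.const _)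

theorem insert_antilipschitz {d k N : ℕ} (j : Fin k ↪ Fin N) (x : Config d N) :
    AntilipschitzWith 1 (insert j x : Config d k → Config d N) := by
  refine AntilipschitzWith.of_le_mul_dist fun y z => ?_
  rw [NNReal.coe_one, one_mul, dist_pi_le_iff dist_nonneg]
  intro i
  have h := dist_le_pi_dist (insert j x y) (insert j x z) (j i)
  simpa only [insert, j.injective.extend_apply] using h

theorem insert_comp_perm {d k N : ℕ} (j : Fin k ↪ Fin N) (x : Config d N) (y : Config d k)
    (σ : Equiv.Perm (Fin k)) :
    insert j x (y ∘ σ) = insert j x y ∘ σ.viaFintypeEmbedding j := by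
  funext a
  by_cases ha : ∃ i, j i = a
  · obtain ⟨i, rfl⟩ := ha
    simp only [insert, Function.comp_apply, Equiv.Perm.viaFintypeEmbedding_apply_image,
      j.injective.extend_apply]
  · have h : a ∉ Set.range j := ha
    rw [Function.comp_apply, Equiv.Perm.viaFintypeEmbedding_apply_notMem_range _ _ h]
    simp only [insert, Function.extend_apply' _ _ _ ha]

/-- A bosonic function of `N` particles as a function of the particles `j_1, …, j_k` only, the
other particles being frozen at their positions in `x`. -/
def slice {d k N : ℕ} (j : Fin k ↪ Fin N) (x : Config d N) (f : Bosonic d N) : Bosonic d k :=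
  ⟨SchwartzMap.compCLMOfAntilipschitz ℂ (insert_hasTemperateGrowth j x)
    (insert_antilipschitz j x) f.1, fun σ y => by
      change f.1 (insert j x (y ∘ σ)) = f.1 (insert j x y)
      rw [insert_comp_perm]
      exact f.2 _ _⟩

theorem slice_apply {d k N : ℕ} (j : Fin k ↪ Fin N) (x : Config d N) (f : Bosonic d N)
    (y : Config d k) : (slice j x f).1 y = f.1 (insert j x y) := rfl

/-- The `k`-particle extension `A_{(j_1, …, j_k)}` of `A`, acting on bosonic functions of `N`
particles: the operator `A` acts in the variables `x_{j_1}, …, x_{j_k}` and the identity acts in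
the others.  For `(j_1, …, j_k) = (1, …, k)` this is `A ⊗ Id`: if `f` is a linear combination of
tensors `u(x_1, …, x_k) v(x_{k+1}, …, x_N)`, its image is that of `(A u) ⊗ v`. -/
def extension {d k N : ℕ} (A : Observable d k) (j : Fin k ↪ Fin N) (f : Bosonic d N) :
    Config d N → ℂ :=
  fun x => (A.op (slice j x f)).1 (x ∘ j)

/-- `E = C_{k,N} ∑ A_{(j_1, …, j_k)}`, where the sum is over all `k`-tuples of distinct elements
of `{1, …, N}` and `C_{k,N} = 1 / (k! (N choose k))` is the inverse of their number. -/
def IsEmbedded {d k N : ℕ} (A : Observable d k) (E : Observable d N) : Prop :=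
  ∀ (f : Bosonic d N) (x : Config d N), (E.op f).1 x =
    ((k.factorial * N.choose k : ℕ) : ℂ)⁻¹ * ∑ j : Fin k ↪ Fin N, extension A j f x

open Classical in
/-- The embedding `ε_{k,N} : 𝔤_k → 𝔤_N`: the value at `A` is the only `E` in `𝔤_N` with
`IsEmbedded A E` (and it would be `0` if there were none). -/
def embed {d k : ℕ} (N : ℕ) (A : Observable d k) : Observable d N :=
  if h : ∃ E : Observable d N, IsEmbedded A E then h.choose else 0

/-- The space `𝔊_N = 𝔤_1 ⊕ … ⊕ 𝔤_N` of observable `N`-hierarchies.  The sum is finite, so the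
locally convex direct sum is the product with the product topology. -/
abbrev Hier (d N : ℕ) : Type := (k : ↥(Finset.Icc 1 N)) → Observable d k.1

/-- The bracket of `𝔊_N`: its component `k` is the sum over all `1 ≤ ℓ, j ≤ N` with
`min (ℓ + j - 1) N = k` of `ε_{k,N}⁻¹ [ε_{ℓ,N} A_ℓ, ε_{j,N} B_j]_{𝔤_N}`, where `ε_{k,N}⁻¹` is
the inverse of `ε_{k,N}` on its image. -/
def bracket {d N : ℕ} (A B : Hier d N) : Hier d N := fun k =>
  ∑ p : ↥(Finset.Icc 1 N) × ↥(Finset.Icc 1 N) with min (p.1.1 + p.2.1 - 1) N = k.1,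
    Function.invFun (embed N : Observable d k.1 → Observable d N)
      (Observable.lie (embed N (A p.1)) (embed N (B p.2)))

/-- A (real) Lie algebra: a Hausdorff locally convex space with a separately continuous binary
operation that is bilinear, alternating, and satisfies the Jacobi identity. -/
structure IsLieAlgebra (E : Type) [AddCommGroup E] [Module ℝ E] [TopologicalSpace E]
    (br : E → E → E) : Prop where
  isTopologicalAddGroup : IsTopologicalAddGroup E
  continuousSMul : ContinuousSMul ℝ E
  locallyConvex : LocallyConvexSpace ℝ E
  hausdorff : T2Space E
  continuous_left : ∀ y, Continuous fun x => br x y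
  continuous_right : ∀ x, Continuous fun y => br x y
  add_left : ∀ x x' y, br (x + x') y = br x y + br x' y
  add_right : ∀ x y y', br x (y + y') = br x y + br x y'
  smul_left : ∀ (c : ℝ) (x y), br (c • x) y = c • br x y
  smul_right : ∀ (c : ℝ) (x y), br x (c • y) = c • br x y
  self : ∀ x, br x x = 0
  jacobi : ∀ x y z, br x (br y z) + br z (br x y) + br y (br z x) = 0

end Hierarchy

end

/-
For a tuple `j` the operator `A_j` is `Id ⊗ A` in the splitting of the `N` particles into those
outside and those inside `j`. It preserves Schwartz functions because `g ↦ f (g, ·)` is a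
differentiable map into the Schwartz space, to which `A` may be applied pointwise.

Relabelling the particles shows that all the `A_j` have the same matrix elements between bosonic
functions, so that `ε_{k,N} A` is the compression of `A ⊗ Id` to the bosonic functions. Its matrix
elements are integrals, over the frozen particles, of matrix elements of `A`; weighting the frozen
particles by a power of `1 + ‖z‖` makes these range over a bounded set, which gives continuity.

Since `⟨q^{⊗N}, ε_{k,N}(A) p^{⊗N}⟩ = ⟨q, p⟩^{N-k} ⟨q^{⊗k}, A p^{⊗k}⟩`, the element `ε_{k,N} A`
determines the second factor when `⟨q, p⟩ ≠ 0`, and by continuity for all `p` and `q`. By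
polarization the powers `p^{⊗k}` span a dense subspace, so `ε_{k,N}` is injective.

The operators `A_i` and `B_j`, for tuples of lengths `k` and `l`, commute when `i` and `j` are
disjoint. Otherwise they involve at most `m = min (k + l - 1) N` particles, and compressing
`[A_i, B_j]` on these `m` particles gives an observable whose image under `ε_{m,N}` is the
contribution of `i` and `j` to the commutator. The Lie algebra identities are inherited from `𝔤_N`
through the injective maps `ε_{k,N}`.
-/

open scoped SchwartzMap

noncomputable section

namespace Hierarchy

open LineDeriv Topology

section Calculus

variable {E F : Type*} [NormedAddCommGroup E] [NormedSpace ℝ E]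
  [NormedAddCommGroup F] [NormedSpace ℝ F]

theorem norm_sub_sub_fderiv_le {h : E → F} (hh : ContDiff ℝ 2 h) {x w : E} {M : ℝ}
    (hM : ∀ z ∈ segment ℝ x (x + w), ‖fderiv ℝ (fderiv ℝ h) z‖ ≤ M) :
    ‖h (x + w) - h x - fderiv ℝ h x w‖ ≤ M * ‖w‖ ^ 2 := by
  have hh' : Differentiable ℝ (fderiv ℝ h) :=
    (hh.fderiv_right (m := 1) (by norm_num)).differentiable one_ne_zero
  have hM₀ : 0 ≤ M :=
    (norm_nonneg (fderiv ℝ (fderiv ℝ h) x)).trans (hM x (left_mem_segment ℝ _ _))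
  have hconv := convex_segment (𝕜 := ℝ) x (x + w)
  have hx := left_mem_segment ℝ x (x + w)
  have hbound : ∀ z ∈ segment ℝ x (x + w), ‖fderiv ℝ h z - fderiv ℝ h x‖ ≤ M * ‖w‖ := by
    intro z hz
    refine (hconv.norm_image_sub_le_of_norm_fderiv_le (fun z _ => hh' z) hM hx hz).trans ?_
    gcongr
    simpa using norm_sub_le_of_mem_segment hz
  simpa [sq, mul_assoc] using hconv.norm_image_sub_le_of_norm_fderiv_le'
    (fun z _ => hh.differentiable two_ne_zero z) hbound hx (right_mem_segment ℝ _ _)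

theorem exists_norm_iteratedFDeriv_succ_le {ι : Type*} [Fintype ι] (b : Module.Basis ι ℝ E) :
    ∃ C : NNReal, ∀ (n : ℕ) (h : E → F) (_ : ContDiff ℝ (n + 1 : ℕ) h) (x : E),
      ‖iteratedFDeriv ℝ (n + 1) h x‖ ≤
        C * ∑ i, ‖iteratedFDeriv ℝ n (fun y => fderiv ℝ h y (b i)) x‖ := by
  have := b.finiteDimensional_of_finite
  let L : ι → F →L[ℝ] E →L[ℝ] F := fun i =>
    ContinuousLinearMap.smulRightL ℝ E F (LinearMap.toContinuousLinearMap (b.coord i))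
  refine ⟨∑ i, ‖L i‖₊, fun n h hh x => ?_⟩
  have hL : fderiv ℝ h = fun y => ∑ i, (L i ∘ fun y => fderiv ℝ h y (b i)) y := by
    funext y
    ext v
    conv_lhs => rw [← b.sum_repr v, map_sum]
    simp [L]
  have hD (i : ι) : ContDiff ℝ n fun y => fderiv ℝ h y (b i) :=
    (hh.fderiv_right (m := n) (by simp)).clm_apply contDiff_const
  rw [← norm_iteratedFDeriv_fderiv]
  conv_lhs => rw [hL]
  rw [iteratedFDeriv_fun_sum_apply fun i _ => ((L i).contDiff.comp (hD i)).contDiffAt,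
    NNReal.coe_sum, Finset.sum_mul]
  refine (norm_sum_le _ _).trans (Finset.sum_le_sum fun i _ => ?_)
  refine ((L i).norm_iteratedFDeriv_comp_left (hD i).contDiffAt le_rfl).trans ?_
  rw [coe_nnnorm]
  gcongr
  exact Finset.single_le_sum (f := fun i => ‖iteratedFDeriv ℝ n (fun y => fderiv ℝ h y (b i)) x‖)
    (fun _ _ => norm_nonneg _) (Finset.mem_univ i)

end Calculus

section Schwartz

variable {E F : Type*} [NormedAddCommGroup E] [NormedSpace ℝ E]
  [NormedAddCommGroup F] [NormedSpace ℝ F]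

theorem lineDeriv_comm (v w : E) (f : 𝓢(E, F)) : ∂_{v} (∂_{w} f) = ∂_{w} (∂_{v} f) := by
  have hf : Differentiable ℝ (fderiv ℝ f) :=
    ((f.smooth 2).fderiv_right (m := 1) (by norm_num)).differentiable one_ne_zero
  have h (a b x : E) : ∂_{a} (∂_{b} f) x = fderiv ℝ (fderiv ℝ f) x a b := by
    have hb : (∂_{b} f : 𝓢(E, F)) = fun y => fderiv ℝ f y b :=
      funext fun y => SchwartzMap.lineDerivOp_apply_eq_fderiv b f y
    rw [SchwartzMap.lineDerivOp_apply_eq_fderiv, hb, fderiv_clm_apply (hf x) (by fun_prop)]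
    simp
  ext x
  rw [h, h]
  exact (f.contDiffAt 2 (x := x)).isSymmSndFDerivAt (by simp) v w

theorem iteratedFDeriv_lineDeriv (n : ℕ) (f : 𝓢(E, F)) (x w : E) :
    iteratedFDeriv ℝ n (∂_{w} f : 𝓢(E, F)) x = fderiv ℝ (iteratedFDeriv ℝ n f) x w := by
  have hcomm (m : Fin n → E) : ∂_{w} (∂^{m} f) = ∂^{m} (∂_{w} f) := by
    induction n with
    | zero => simp
    | succ n ih =>
      rw [iteratedLineDerivOp_succ_left, iteratedLineDerivOp_succ_left, lineDeriv_comm, ih]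
  ext m
  have h : ∂^{(Fin.cons w m : Fin (n + 1) → E)} f x =
      iteratedFDeriv ℝ (n + 1) f x (Fin.cons w m) :=
    SchwartzMap.iteratedLineDerivOp_eq_iteratedFDeriv
  rw [iteratedLineDerivOp_succ_left, iteratedFDeriv_succ_apply_left] at h
  rw [← SchwartzMap.iteratedLineDerivOp_eq_iteratedFDeriv, ← hcomm]
  simpa using h

theorem norm_iteratedFDeriv_taylor_le (n : ℕ) (f : 𝓢(E, F)) {x w : E} {M : ℝ}
    (hM : ∀ z ∈ segment ℝ x (x + w), ‖iteratedFDeriv ℝ (n + 2) f z‖ ≤ M) :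
    ‖iteratedFDeriv ℝ n f (x + w) - iteratedFDeriv ℝ n f x -
      iteratedFDeriv ℝ n (∂_{w} f : 𝓢(E, F)) x‖ ≤ M * ‖w‖ ^ 2 := by
  rw [iteratedFDeriv_lineDeriv]
  refine norm_sub_sub_fderiv_le
    ((f.smooth (n + 2 : ℕ)).iteratedFDeriv_right (by simp [add_comm])) fun z hz => ?_
  rw [fderiv_iteratedFDeriv, LinearIsometryEquiv.comp_fderiv]
  refine ((LinearIsometryEquiv.toLinearIsometry _).norm_toContinuousLinearMap_comp).trans_le ?_
  rw [norm_fderiv_iteratedFDeriv]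
  exact hM z hz

theorem iteratedFDeriv_taylorRemainder (n : ℕ) (f : 𝓢(E, F)) (x w : E) :
    iteratedFDeriv ℝ n (SchwartzMap.compSubConstCLM ℝ (-w) f - f - ∂_{w} f : 𝓢(E, F)) x =
      iteratedFDeriv ℝ n f (x + w) - iteratedFDeriv ℝ n f x -
        iteratedFDeriv ℝ n (∂_{w} f : 𝓢(E, F)) x := by
  have h : ⇑(SchwartzMap.compSubConstCLM ℝ (-w) f - f - ∂_{w} f : 𝓢(E, F)) =
      (fun z => f (z + w)) - f - (∂_{w} f : 𝓢(E, F)) := by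
    funext z
    simp
  have hs : ContDiff ℝ n fun z => f (z + w) := (f.smooth n).comp (contDiff_id.add contDiff_const)
  rw [h, iteratedFDeriv_sub_apply, iteratedFDeriv_sub_apply, iteratedFDeriv_comp_add_right]
  · exact hs.contDiffAt
  · exact f.contDiffAt n
  · exact (hs.sub (f.smooth n)).contDiffAt
  · exact SchwartzMap.contDiffAt _ n

end Schwartz

section Slices

variable {𝕜 : Type*} [RCLike 𝕜] {G E E' F F' : Type*}
  [NormedAddCommGroup G] [NormedSpace ℝ G] [NormedAddCommGroup E] [NormedSpace ℝ E]
  [NormedAddCommGroup E'] [NormedSpace ℝ E']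
  [NormedAddCommGroup F] [NormedSpace ℝ F] [NormedSpace 𝕜 F] [SMulCommClass ℝ 𝕜 F]
  [NormedAddCommGroup F'] [NormedSpace ℝ F'] [NormedSpace 𝕜 F'] [SMulCommClass ℝ 𝕜 F']

theorem exists_seminorm_le_of_shift {p : Seminorm 𝕜 𝓢(E, F)} (hp : Continuous p) (c m : ℕ) :
    ∃ q : Seminorm 𝕜 𝓢(E', F'), Continuous q ∧ ∀ (f : 𝓢(E, F)) (g : 𝓢(E', F')) (r : ℝ),
      (∀ a b, SchwartzMap.seminorm 𝕜 a b f ≤ r * SchwartzMap.seminorm 𝕜 (c + a) (b + m) g) →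
        p f ≤ r * q g := by
  obtain ⟨s, C, -, hC⟩ := Seminorm.bound_of_continuous (schwartz_withSeminorms 𝕜 E F) p hp
  refine ⟨∑ n ∈ s, C • SchwartzMap.seminorm 𝕜 (c + n.1) (n.2 + m), ?_, fun f g r h => ?_⟩
  · have hcont : Continuous fun g : 𝓢(E', F') =>
        ∑ n ∈ s, C • SchwartzMap.seminorm 𝕜 (c + n.1) (n.2 + m) g :=
      continuous_finsetSum _ fun n _ => continuous_const.smul
        ((schwartz_withSeminorms 𝕜 E' F').continuous_seminorm (c + n.1, n.2 + m))
    simpa only [← sum_apply, ← smul_apply] using hcont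
  · rw [sum_apply, Finset.mul_sum]
    calc p f ≤ C • (s.sup (schwartzSeminormFamily 𝕜 E F)) f := hC f
      _ ≤ C • ∑ n ∈ s, SchwartzMap.seminorm 𝕜 n.1 n.2 f := by
          have := Seminorm.finset_sup_le_sum (schwartzSeminormFamily 𝕜 E F) s f
          rw [sum_apply] at this
          exact smul_le_smul_of_nonneg_left this C.2
      _ ≤ _ := by
          rw [Finset.smul_sum]
          refine Finset.sum_le_sum fun n _ => ?_
          rw [smul_apply, mul_smul_comm]
          exact smul_le_smul_of_nonneg_left (h n.1 n.2) C.2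

variable (𝕜) in
/-- The slice `e ↦ f (g, e)` of a Schwartz function on a product. -/
def sliceAt (g : G) : 𝓢(G × E, F) →L[𝕜] 𝓢(E, F) :=
  SchwartzMap.compCLMOfAntilipschitz 𝕜 (g := fun e => (g, e)) (K := 1)
    (by
      have h : (fun e : E => (g, e)) = fun e => ContinuousLinearMap.inr ℝ G E e + (g, 0) := by
        funext e
        simp
      rw [h]
      exact (ContinuousLinearMap.inr ℝ G E).hasTemperateGrowth.add (.const _))
    (AntilipschitzWith.of_le_mul_dist fun e e' => by simp [Prod.dist_eq])

@[simp]
theorem sliceAt_apply (g : G) (f : 𝓢(G × E, F)) (e : E) : sliceAt 𝕜 g f e = f (g, e) := rfl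

theorem norm_iteratedFDeriv_sliceAt_le (g : G) (f : 𝓢(G × E, F)) (n : ℕ) (e : E) :
    ‖iteratedFDeriv ℝ n (sliceAt 𝕜 g f) e‖ ≤ ‖iteratedFDeriv ℝ n f (g, e)‖ := by
  have h : (sliceAt 𝕜 g f : E → F) =
      (fun z => f (z + (g, 0))) ∘ ContinuousLinearMap.inr ℝ G E := by
    funext e
    simp
  have hf : ContDiff ℝ n fun z => f (z + (g, 0)) :=
    (f.smooth n).comp (contDiff_id.add contDiff_const)
  rw [h, (ContinuousLinearMap.inr ℝ G E).iteratedFDeriv_comp_right hf _ le_rfl,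
    iteratedFDeriv_comp_add_right]
  refine (ContinuousMultilinearMap.norm_compContinuousLinearMap_le _ _).trans ?_
  simpa using mul_le_of_le_one_right (norm_nonneg (iteratedFDeriv ℝ n f (g, e)))
    (Finset.prod_le_one (s := (Finset.univ : Finset (Fin n))) (fun _ _ => norm_nonneg _)
      fun _ _ => ContinuousLinearMap.norm_inr_le_one ℝ G E)

theorem exists_pow_mul_seminorm_sliceAt_le {p : Seminorm 𝕜 𝓢(E, F)} (hp : Continuous p) (c : ℕ) :
    ∃ q : Seminorm 𝕜 𝓢(G × E, F), Continuous q ∧ ∀ f g, ‖g‖ ^ c * p (sliceAt 𝕜 g f) ≤ q f := by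
  obtain ⟨q, hq, h⟩ := exists_seminorm_le_of_shift (E' := G × E) (F' := F) hp c 0
  refine ⟨q, hq, fun f g => ?_⟩
  have key := h (((‖g‖ ^ c : ℝ) : 𝕜) • sliceAt 𝕜 g f) f 1 fun a b => ?_
  · simpa [map_smul_eq_mul] using key
  rw [one_mul, add_zero]
  refine SchwartzMap.seminorm_le_bound 𝕜 a b _ (apply_nonneg _ _) fun e => ?_
  calc ‖e‖ ^ a * ‖iteratedFDeriv ℝ b (((‖g‖ ^ c : ℝ) : 𝕜) • sliceAt 𝕜 g f) e‖
      = ‖g‖ ^ c * ‖e‖ ^ a * ‖iteratedFDeriv ℝ b (sliceAt 𝕜 g f) e‖ := by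
        rw [FunLike.coe_smul, iteratedFDeriv_const_smul_apply ((sliceAt 𝕜 g f).contDiffAt b),
          norm_smul, RCLike.norm_ofReal, abs_of_nonneg (by positivity)]
        ring
    _ ≤ ‖(g, e)‖ ^ c * ‖(g, e)‖ ^ a * ‖iteratedFDeriv ℝ b f (g, e)‖ := by
        gcongr
        · exact norm_fst_le (g, e)
        · exact norm_snd_le (g, e)
        · exact norm_iteratedFDeriv_sliceAt_le g f b e
    _ ≤ _ := by
        rw [← pow_add]
        exact SchwartzMap.le_seminorm 𝕜 (c + a) b f (g, e)

theorem exists_seminorm_sliceAt_taylor_le {p : Seminorm 𝕜 𝓢(E, F)} (hp : Continuous p) :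
    ∃ q : Seminorm 𝕜 𝓢(G × E, F), Continuous q ∧ ∀ f g v,
      p (sliceAt 𝕜 (g + v) f - sliceAt 𝕜 g f - sliceAt 𝕜 g (∂_{(v, (0 : E))} f)) ≤
        ‖v‖ ^ 2 * q f := by
  obtain ⟨q, hq, h⟩ := exists_seminorm_le_of_shift (E' := G × E) (F' := F) hp 0 2
  refine ⟨q, hq, fun f g v => h _ f _ fun a b => ?_⟩
  set w : G × E := (v, 0) with hw
  let R : 𝓢(G × E, F) := SchwartzMap.compSubConstCLM ℝ (-w) f - f - ∂_{w} f
  have hR : sliceAt 𝕜 (g + v) f - sliceAt 𝕜 g f - sliceAt 𝕜 g (∂_{w} f) = sliceAt 𝕜 g R := by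
    ext e
    simp [R, hw]
  rw [hR, zero_add]
  refine SchwartzMap.seminorm_le_bound 𝕜 a b _ (by positivity) fun e => ?_
  rcases (pow_nonneg (norm_nonneg e) a).eq_or_lt with he | he
  · rw [← he, zero_mul]
    positivity
  have htaylor := norm_iteratedFDeriv_taylor_le b f (x := (g, e)) (w := w)
    (M := SchwartzMap.seminorm 𝕜 a (b + 2) f / ‖e‖ ^ a) fun z hz => by
      obtain ⟨t, -, rfl⟩ := (segment_eq_image' ℝ (g, e) ((g, e) + w)).le hz
      rw [le_div_iff₀' he]
      refine le_trans ?_ (SchwartzMap.le_seminorm 𝕜 a (b + 2) f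
        ((g, e) + t • ((g, e) + w - (g, e))))
      beta_reduce
      gcongr
      simp [hw]
  calc ‖e‖ ^ a * ‖iteratedFDeriv ℝ b (sliceAt 𝕜 g R) e‖
      ≤ ‖e‖ ^ a * (SchwartzMap.seminorm 𝕜 a (b + 2) f / ‖e‖ ^ a * ‖w‖ ^ 2) := by
        gcongr
        exact (norm_iteratedFDeriv_sliceAt_le g R b e).trans
          ((iteratedFDeriv_taylorRemainder b f _ w).symm ▸ htaylor)
    _ = ‖v‖ ^ 2 * SchwartzMap.seminorm 𝕜 a (b + 2) f := by
        rw [hw, Prod.norm_mk, norm_zero, max_eq_left (norm_nonneg v)]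
        field_simp

end Slices

section IdTensor

variable {𝕜 : Type*} [RCLike 𝕜] {G E E' F F' : Type*}
  [NormedAddCommGroup G] [NormedSpace ℝ G]
  [NormedAddCommGroup E] [NormedSpace ℝ E] [NormedAddCommGroup E'] [NormedSpace ℝ E']
  [NormedAddCommGroup F] [NormedSpace ℝ F] [NormedSpace 𝕜 F] [IsScalarTower ℝ 𝕜 F]
  [NormedAddCommGroup F'] [NormedSpace ℝ F'] [NormedSpace 𝕜 F'] [IsScalarTower ℝ 𝕜 F']

/-- The function `(g, e) ↦ (T f(g, ·))(e)`. -/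
def idTensorFun (T : 𝓢(E, F) →L[𝕜] 𝓢(E', F')) (f : 𝓢(G × E, F)) (x : G × E') : F' :=
  T (sliceAt 𝕜 x.1 f) x.2

theorem exists_seminorm_idTensorFun_le (T : 𝓢(E, F) →L[𝕜] 𝓢(E', F')) (a : ℕ) :
    ∃ q : Seminorm 𝕜 𝓢(G × E, F), Continuous q ∧ ∀ f x, ‖x‖ ^ a * ‖idTensorFun T f x‖ ≤ q f := by
  have hcont (b : ℕ) : Continuous ((SchwartzMap.seminorm 𝕜 b 0).comp T.toLinearMap) :=
    ((schwartz_withSeminorms 𝕜 E' F').continuous_seminorm (b, 0)).comp T.continuous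
  obtain ⟨q₁, hq₁, h₁⟩ := exists_pow_mul_seminorm_sliceAt_le (G := G) (hcont 0) a
  obtain ⟨q₂, hq₂, h₂⟩ := exists_pow_mul_seminorm_sliceAt_le (G := G) (hcont a) 0
  refine ⟨q₁ + q₂, hq₁.add hq₂, fun f x => ?_⟩
  have hx : ‖x‖ ^ a ≤ ‖x.1‖ ^ a + ‖x.2‖ ^ a := by
    rw [Prod.norm_def]
    rcases max_choice ‖x.1‖ ‖x.2‖ with h | h <;> rw [h]
    · exact le_add_of_nonneg_right (by positivity)
    · exact le_add_of_nonneg_left (by positivity)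
  calc ‖x‖ ^ a * ‖idTensorFun T f x‖
      ≤ ‖x.1‖ ^ a * ‖idTensorFun T f x‖ + ‖x.2‖ ^ a * ‖idTensorFun T f x‖ := by
        rw [← add_mul]
        gcongr
    _ ≤ ‖x.1‖ ^ a * SchwartzMap.seminorm 𝕜 0 0 (T (sliceAt 𝕜 x.1 f)) +
          ‖x.1‖ ^ 0 * SchwartzMap.seminorm 𝕜 a 0 (T (sliceAt 𝕜 x.1 f)) := by
        rw [pow_zero, one_mul]
        gcongr
        · exact SchwartzMap.norm_le_seminorm 𝕜 _ _
        · exact SchwartzMap.norm_pow_mul_le_seminorm 𝕜 _ _ _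
    _ ≤ q₁ f + q₂ f := add_le_add (h₁ f x.1) (h₂ f x.1)

variable [FiniteDimensional ℝ G]

/-- The derivative of a Schwartz function on a product in the directions of the first factor. -/
def fstDeriv (f : 𝓢(G × E, F)) : G →L[ℝ] 𝓢(G × E, F) :=
  LinearMap.toContinuousLinearMap
    { toFun := fun v => ∂_{(v, (0 : E))} f
      map_add' := fun v w => by
        rw [← lineDerivOp_left_add, Prod.mk_add_mk, add_zero]
      map_smul' := fun c v => by
        rw [RingHom.id_apply, ← lineDerivOp_left_smul, Prod.smul_mk, smul_zero] }

theorem continuous_sliceAt (f : 𝓢(G × E, F)) : Continuous fun g => sliceAt 𝕜 g f := by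
  refine continuous_iff_continuousAt.2 fun g => ?_
  rw [ContinuousAt, ← tendsto_sub_nhds_zero_iff, ← map_add_left_nhds_zero, Filter.tendsto_map'_iff,
    (schwartz_withSeminorms 𝕜 E F).tendsto_nhds _ _]
  intro i ε hε
  set p := schwartzSeminormFamily 𝕜 E F i
  have hp : Continuous p := (schwartz_withSeminorms 𝕜 E F).continuous_seminorm i
  obtain ⟨q, -, hq⟩ := exists_seminorm_sliceAt_taylor_le (G := G) hp
  have hcont : Continuous fun v : G => ‖v‖ ^ 2 * q f + p (sliceAt 𝕜 g (fstDeriv f v)) :=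
    (by fun_prop : Continuous fun v : G => ‖v‖ ^ 2 * q f).add
      (hp.comp ((sliceAt 𝕜 g).continuous.comp (fstDeriv f).continuous))
  have hlim := hcont.tendsto 0
  simp only [norm_zero, map_zero, ne_eq, OfNat.ofNat_ne_zero, not_false_eq_true, zero_pow, zero_mul,
    add_zero] at hlim
  filter_upwards [hlim.eventually_lt_const hε] with v hv
  rw [Function.comp_apply, sub_zero]
  calc p (sliceAt 𝕜 (g + v) f - sliceAt 𝕜 g f)
      ≤ p (sliceAt 𝕜 (g + v) f - sliceAt 𝕜 g f - sliceAt 𝕜 g (fstDeriv f v)) +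
          p (sliceAt 𝕜 g (fstDeriv f v)) := by
        simpa using map_add_le_add p (sliceAt 𝕜 (g + v) f - sliceAt 𝕜 g f -
          sliceAt 𝕜 g (fstDeriv f v)) (sliceAt 𝕜 g (fstDeriv f v))
    _ ≤ ‖v‖ ^ 2 * q f + p (sliceAt 𝕜 g (fstDeriv f v)) := by
        gcongr
        exact hq f g v
    _ < ε := hv

theorem hasFDerivAt_map_sliceAt (ℓ : 𝓢(E, F) →L[𝕜] F') (f : 𝓢(G × E, F)) (g : G) :
    HasFDerivAt (fun g => ℓ (sliceAt 𝕜 g f))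
      ((ℓ ∘L sliceAt 𝕜 g).restrictScalars ℝ ∘L fstDeriv f) g := by
  obtain ⟨q, -, hq⟩ := exists_seminorm_sliceAt_taylor_le (G := G)
    (p := (normSeminorm 𝕜 F').comp ℓ.toLinearMap) (continuous_norm.comp ℓ.continuous)
  rw [hasFDerivAt_iff_isLittleO_nhds_zero]
  refine (Asymptotics.IsBigO.of_bound (q f) (Filter.Eventually.of_forall fun v => ?_) :
    _ =O[𝓝 0] fun v : G => ‖v‖ ^ 2).trans_isLittleO (Asymptotics.isLittleO_norm_pow_id one_lt_two)
  simpa [fstDeriv, mul_comm] using hq f g v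

theorem continuous_idTensorFun (T : 𝓢(E, F) →L[𝕜] 𝓢(E', F')) (f : 𝓢(G × E, F)) :
    Continuous (idTensorFun T f) :=
  (((SchwartzMap.toBoundedContinuousFunctionCLM 𝕜 E' F').continuous.comp
    (T.continuous.comp (continuous_sliceAt (𝕜 := 𝕜) f))).comp continuous_fst).eval continuous_snd

/-- The partial derivative of `idTensorFun T f` in the directions of `G`. -/
def idTensorFstDeriv (T : 𝓢(E, F) →L[𝕜] 𝓢(E', F')) (f : 𝓢(G × E, F)) (g : G) (e : E') :
    G →L[ℝ] F' :=
  (BoundedContinuousFunction.evalCLM 𝕜 e ∘L SchwartzMap.toBoundedContinuousFunctionCLM 𝕜 E' F' ∘L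
    T ∘L sliceAt 𝕜 g).restrictScalars ℝ ∘L fstDeriv f

theorem hasFDerivAt_idTensorFun (T : 𝓢(E, F) →L[𝕜] 𝓢(E', F')) (f : 𝓢(G × E, F)) (x : G × E') :
    HasFDerivAt (idTensorFun T f) ((idTensorFstDeriv T f x.1 x.2).coprod
      (idTensorFun (SchwartzMap.fderivCLM 𝕜 E' F' ∘L T) f x)) x := by
  have hfst : Continuous fun x : G × E' => idTensorFstDeriv T f x.1 x.2 :=
    continuous_clm_apply.2 fun v => continuous_idTensorFun T (fstDeriv f v)
  have hsnd : Continuous (idTensorFun (SchwartzMap.fderivCLM 𝕜 E' F' ∘L T) f) :=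
    continuous_idTensorFun _ f
  exact (hasStrictFDerivAt_uncurry_coprod (f := fun g e => T (sliceAt 𝕜 g f) e)
    (f₁ := fun g e => idTensorFstDeriv T f g e)
    (f₂ := fun g e => idTensorFun (SchwartzMap.fderivCLM 𝕜 E' F' ∘L T) f (g, e))
    (.of_forall fun y => hasFDerivAt_map_sliceAt (BoundedContinuousFunction.evalCLM 𝕜 y.2 ∘L
      SchwartzMap.toBoundedContinuousFunctionCLM 𝕜 E' F' ∘L T) f y.1)
    (.of_forall fun y => (T (sliceAt 𝕜 y.1 f)).differentiable.differentiableAt.hasFDerivAt)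
    hfst.continuousAt hsnd.continuousAt).hasFDerivAt

theorem fderiv_idTensorFun (T : 𝓢(E, F) →L[𝕜] 𝓢(E', F')) (f : 𝓢(G × E, F)) (w : G × E') :
    (fun x => fderiv ℝ (idTensorFun T f) x w) = idTensorFun T (∂_{(w.1, (0 : E))} f) +
      idTensorFun (lineDerivOpCLM 𝕜 𝓢(E', F') w.2 ∘L T) f :=
  funext fun x => by
    rw [(hasFDerivAt_idTensorFun T f x).fderiv]
    rfl

variable [FiniteDimensional ℝ E']

theorem contDiff_idTensorFun (n : ℕ) (T : 𝓢(E, F) →L[𝕜] 𝓢(E', F')) (f : 𝓢(G × E, F)) :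
    ContDiff ℝ n (idTensorFun T f) := by
  induction n generalizing T f with
  | zero => exact contDiff_zero.2 (continuous_idTensorFun T f)
  | succ n ih =>
    rw [Nat.cast_add, Nat.cast_one]
    refine contDiff_succ_iff_fderiv_apply.2
      ⟨fun x => (hasFDerivAt_idTensorFun T f x).differentiableAt, ?_, fun w => ?_⟩
    · exact fun h => absurd h (by simp)
    · rw [fderiv_idTensorFun]
      exact (ih _ _).add (ih _ _)

theorem exists_seminorm_iteratedFDeriv_idTensorFun_le (a n : ℕ) (T : 𝓢(E, F) →L[𝕜] 𝓢(E', F')) :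
    ∃ q : Seminorm 𝕜 𝓢(G × E, F), Continuous q ∧
      ∀ f x, ‖x‖ ^ a * ‖iteratedFDeriv ℝ n (idTensorFun T f) x‖ ≤ q f := by
  induction n generalizing T with
  | zero => simpa only [norm_iteratedFDeriv_zero] using exists_seminorm_idTensorFun_le T a
  | succ n ih =>
    let b := Module.finBasis ℝ (G × E')
    obtain ⟨C, hb⟩ := exists_norm_iteratedFDeriv_succ_le (F := F') b
    obtain ⟨q₁, hq₁, h₁⟩ := ih T
    choose q₂ hq₂ h₂ using fun i => ih (lineDerivOpCLM 𝕜 𝓢(E', F') (b i).2 ∘L T)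
    let D i := lineDerivOpCLM 𝕜 𝓢(G × E, F) ((b i).1, (0 : E))
    have hsum (f x) (i) : ‖x‖ ^ a *
        ‖iteratedFDeriv ℝ n (fun y => fderiv ℝ (idTensorFun T f) y (b i)) x‖ ≤
          q₁ (D i f) + q₂ i f := by
      rw [fderiv_idTensorFun, iteratedFDeriv_add_apply (contDiff_idTensorFun n _ _).contDiffAt
        (contDiff_idTensorFun n _ _).contDiffAt]
      calc _ ≤ ‖x‖ ^ a * (_ + _) := by gcongr; exact norm_add_le _ _
        _ = _ := mul_add _ _ _
        _ ≤ _ := add_le_add (h₁ _ x) (h₂ i f x)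
    refine ⟨C • ∑ i, (q₁.comp (D i).toLinearMap + q₂ i), ?_, fun f x => ?_⟩
    · have hcont : Continuous fun f => C * ∑ i, (q₁ (D i f) + q₂ i f) :=
        continuous_const.mul (continuous_finsetSum _ fun i _ =>
          (hq₁.comp (D i).continuous).add (hq₂ i))
      convert hcont using 2 with f
      simp [NNReal.smul_def]
    · calc ‖x‖ ^ a * ‖iteratedFDeriv ℝ (n + 1) (idTensorFun T f) x‖
          ≤ ‖x‖ ^ a * (C * ∑ i,
              ‖iteratedFDeriv ℝ n (fun y => fderiv ℝ (idTensorFun T f) y (b i)) x‖) := by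
            gcongr
            exact hb n _ (contDiff_idTensorFun _ T f) x
        _ ≤ C * ∑ i, (q₁ (D i f) + q₂ i f) := by
            rw [mul_left_comm, Finset.mul_sum]
            gcongr with i
            exact hsum f x i
        _ = _ := by simp [NNReal.smul_def]

/-- The operator `Id ⊗ T`, which applies `T` in the second variable. -/
def idTensor (T : 𝓢(E, F) →L[𝕜] 𝓢(E', F')) : 𝓢(G × E, F) →L[𝕜] 𝓢(G × E', F') :=
  SchwartzMap.mkCLM (idTensorFun T)
    (fun f g x => by simp [idTensorFun])
    (fun c f x => by simp [idTensorFun])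
    (fun f => contDiff_infty.2 fun n => contDiff_idTensorFun n T f)
    (fun n => by
      obtain ⟨q, hq, h⟩ := exists_seminorm_iteratedFDeriv_idTensorFun_le (G := G) n.1 n.2 T
      obtain ⟨s, C, -, hs⟩ := Seminorm.bound_of_continuous (schwartz_withSeminorms 𝕜 _ _) q hq
      exact ⟨s, C, C.2, fun f x => (h f x).trans (hs f)⟩)

end IdTensor

section L2Form

open MeasureTheory

variable {E : Type*} [NormedAddCommGroup E] [NormedSpace ℝ E] [MeasureSpace E] [BorelSpace E]
  [(volume : Measure E).HasTemperateGrowth]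

/-- The `L²` form `⟨f, g⟩ = ∫ conj f · g` of Schwartz functions. -/
def l2Form : 𝓢(E, ℂ) →ₗ⋆[ℂ] 𝓢(E, ℂ) →ₗ[ℂ] ℂ :=
  let L := (SchwartzMap.toLpCLM ℂ ℂ 2 volume : 𝓢(E, ℂ) →L[ℂ] Lp ℂ 2 volume).toLinearMap
  ((innerₛₗ ℂ).comp L).compl₂ L

theorem l2Form_apply (f g : 𝓢(E, ℂ)) : l2Form f g = ∫ x, (starRingEnd ℂ) (f x) * g x :=
  integral_congr_ae <| by
    filter_upwards [f.coeFn_toLp 2 volume, g.coeFn_toLp 2 volume] with x hf hg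
    exact (congrArg₂ (inner ℂ) hf hg).trans (mul_comm _ _)

theorem eq_zero_of_l2Form_self [(volume : Measure E).IsOpenPosMeasure] {f : 𝓢(E, ℂ)}
    (h : l2Form f f = 0) : f = 0 :=
  f.injective_toLp 2 volume <| (inner_self_eq_zero (𝕜 := ℂ)).1 h |>.trans
    (map_zero (SchwartzMap.toLpCLM ℂ ℂ 2 volume)).symm

theorem l2Form_conj_symm (f g : 𝓢(E, ℂ)) : (starRingEnd ℂ) (l2Form f g) = l2Form g f :=
  inner_conj_symm (𝕜 := ℂ) (g.toLp 2 volume) (f.toLp 2 volume)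

theorem integrable_conj_mul (f g : 𝓢(E, ℂ)) : Integrable fun x => (starRingEnd ℂ) (f x) * g x := by
  refine (L2.integrable_inner (𝕜 := ℂ) (f.toLp 2 volume) (g.toLp 2 volume)).congr ?_
  filter_upwards [f.coeFn_toLp 2 volume, g.coeFn_toLp 2 volume] with x hf hg
  rw [hf, hg, RCLike.inner_apply, mul_comm]

/-- Skew-adjointness with respect to the `L²` form. -/
def IsSkew (T : 𝓢(E, ℂ) →L[ℂ] 𝓢(E, ℂ)) : Prop := ∀ f g, l2Form (T f) g = -l2Form f (T g)

theorem IsSkew.lie {S T : 𝓢(E, ℂ) →L[ℂ] 𝓢(E, ℂ)} (hS : IsSkew S) (hT : IsSkew T) :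
    IsSkew ⁅S, T⁆ := fun f g => by
  have h (u : 𝓢(E, ℂ)) : ⁅S, T⁆ u = S (T u) - T (S u) := rfl
  rw [h, h, map_sub, LinearMap.sub_apply, map_sub, hS, hT, hT, hS]
  ring

end L2Form

/-- The Schwartz functions of `k` particles, without any symmetry. -/
abbrev Test (d k : ℕ) : Type := 𝓢(Config d k, ℂ)

section Lift

variable {d k l N : ℕ}

theorem insert_apply_self (j : Fin k ↪ Fin N) (x : Config d N) (y : Config d k) (i : Fin k) :
    insert j x y (j i) = y i := j.injective.extend_apply _ _ _

theorem insert_apply_of_notMem (j : Fin k ↪ Fin N) (x : Config d N) (y : Config d k) {a : Fin N}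
    (ha : a ∉ Set.range j) : insert j x y a = x a := Function.extend_apply' _ _ _ ha

theorem insert_comp (j : Fin k ↪ Fin N) (x : Config d N) (y : Config d k) :
    insert j x y ∘ j = y := funext fun i => insert_apply_self j x y i

/-- The particles that do not occur in `j`. -/
abbrev Rest (j : Fin k ↪ Fin N) : Type := ↥(Set.range j)ᶜ

/-- The positions of the particles that do not occur in `j`. -/
abbrev RestConfig (d : ℕ) (j : Fin k ↪ Fin N) : Type := Rest j → EuclideanSpace ℝ (Fin d)

/-- The positions in `x` of the particles that do not occur in `j`. -/
def rest (j : Fin k ↪ Fin N) (x : Config d N) : RestConfig d j := fun a => x a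

theorem rest_insert (j : Fin k ↪ Fin N) (x : Config d N) (y : Config d k) :
    rest j (insert j x y) = rest j x := funext fun a => insert_apply_of_notMem j x y a.2

open Classical in
/-- The splitting of `{1, …, N}` into the particles that do not occur in `j` and those that do. -/
def restSumEquiv (j : Fin k ↪ Fin N) : Rest j ⊕ Fin k ≃ Fin N :=
  ((Equiv.sumComm _ _).trans ((Equiv.ofInjective j j.injective).sumCongr (Equiv.refl _))).trans
    (Equiv.Set.sumCompl (Set.range j))

/-- The splitting `(ℝ^d)^N ≅ (ℝ^d)^{N-k} × (ℝ^d)^k` that isolates the particles of `j`. -/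
def split (j : Fin k ↪ Fin N) : Config d N ≃L[ℝ] RestConfig d j × Config d k :=
  ((LinearEquiv.funCongrLeft ℝ (EuclideanSpace ℝ (Fin d)) (restSumEquiv j)).trans
    (LinearEquiv.sumArrowLequivProdArrow _ _ ℝ _)).toContinuousLinearEquiv

theorem split_apply (j : Fin k ↪ Fin N) (x : Config d N) : split j x = (rest j x, x ∘ j) := rfl

theorem split_symm_rest (j : Fin k ↪ Fin N) (x : Config d N) (y : Config d k) :
    (split j).symm (rest j x, y) = insert j x y := by
  rw [ContinuousLinearEquiv.symm_apply_eq, split_apply, rest_insert, insert_comp]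

theorem measurePreserving_split (j : Fin k ↪ Fin N) :
    MeasureTheory.MeasurePreserving (split j : Config d N → RestConfig d j × Config d k) :=
  (MeasureTheory.volume_measurePreserving_sumPiEquivProdPi _).comp
    (MeasureTheory.volume_measurePreserving_piCongrLeft
      (fun _ => EuclideanSpace ℝ (Fin d)) (restSumEquiv j)).symm

/-- A function of `N` particles as a function of the particles of `j` only, the others being frozen
at the positions `z`. -/
def sliceMap (j : Fin k ↪ Fin N) (z : RestConfig d j) : Test d N →L[ℂ] Test d k :=
  sliceAt ℂ z ∘L SchwartzMap.compCLMOfContinuousLinearEquiv ℂ (split j).symm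

theorem sliceMap_apply (j : Fin k ↪ Fin N) (z : RestConfig d j) (F : Test d N) (y : Config d k) :
    sliceMap j z F y = F ((split j).symm (z, y)) := rfl

theorem sliceMap_rest_apply (j : Fin k ↪ Fin N) (x : Config d N) (F : Test d N) (y : Config d k) :
    sliceMap j (rest j x) F y = F (insert j x y) := by
  rw [sliceMap_apply, split_symm_rest]

theorem slice_val (j : Fin k ↪ Fin N) (x : Config d N) (f : Bosonic d N) :
    (slice j x f).1 = sliceMap j (rest j x) f.1 :=
  SchwartzMap.ext fun y => (sliceMap_rest_apply j x f.1 y).symm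

theorem sliceMap_mem_bosonic (j : Fin k ↪ Fin N) (z : RestConfig d j) (f : Bosonic d N) :
    sliceMap j z f.1 ∈ bosonic d k := by
  have hz : rest j ((split j).symm (z, 0)) = z :=
    congrArg Prod.fst ((split j).apply_symm_apply (z, 0))
  rw [← hz, ← slice_val]
  exact (slice j _ f).2

theorem l2Form_eq_integral_sliceMap (j : Fin k ↪ Fin N) (F G : Test d N) :
    l2Form F G = ∫ z, l2Form (sliceMap j z F) (sliceMap j z G) := by
  let e : Config d N ≃ᵐ RestConfig d j × Config d k := (split j).toHomeomorph.toMeasurableEquiv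
  have he : MeasureTheory.MeasurePreserving e.symm := (measurePreserving_split j).symm e
  simp only [l2Form_apply]
  rw [← he.integral_comp']
  exact MeasureTheory.integral_prod _
    ((he.integrable_comp_emb e.symm.measurableEmbedding).2 (integrable_conj_mul F G))

/-- The operator on functions of `N` particles which acts as `T` in the variables
`x_{j_1}, …, x_{j_k}` and as the identity in the others. -/
def lift (j : Fin k ↪ Fin N) (T : Test d k →L[ℂ] Test d k) : Test d N →L[ℂ] Test d N :=
  SchwartzMap.compCLMOfContinuousLinearEquiv ℂ (split j) ∘L idTensor T ∘L
    SchwartzMap.compCLMOfContinuousLinearEquiv ℂ (split j).symm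

theorem lift_apply (j : Fin k ↪ Fin N) (T : Test d k →L[ℂ] Test d k) (F : Test d N)
    (x : Config d N) : lift j T F x = T (sliceMap j (rest j x) F) (x ∘ j) := rfl

theorem sliceMap_lift (j : Fin k ↪ Fin N) (z : RestConfig d j) (T : Test d k →L[ℂ] Test d k)
    (F : Test d N) : sliceMap j z (lift j T F) = T (sliceMap j z F) := by
  ext y
  obtain ⟨hz, hy⟩ := Prod.ext_iff.1 ((split j).apply_symm_apply (z, y))
  rw [split_apply] at hz hy
  rw [sliceMap_apply, lift_apply]
  exact congrArg₂ (fun z y => T (sliceMap j z F) y) hz hy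

theorem lift_mul (j : Fin k ↪ Fin N) (S T : Test d k →L[ℂ] Test d k) :
    lift j (S * T) = lift j S * lift j T := by
  ext F x
  change lift j (S * T) F x = lift j S (lift j T F) x
  rw [lift_apply, lift_apply, sliceMap_lift]
  rfl

theorem lift_lie (j : Fin k ↪ Fin N) (S T : Test d k →L[ℂ] Test d k) :
    lift j ⁅S, T⁆ = ⁅lift j S, lift j T⁆ := by
  rw [Ring.lie_def, Ring.lie_def, ← lift_mul, ← lift_mul]
  rfl

theorem l2Form_lift (j : Fin k ↪ Fin N) (T : Test d k →L[ℂ] Test d k) (F G : Test d N) :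
    l2Form F (lift j T G) = ∫ z, l2Form (sliceMap j z F) (T (sliceMap j z G)) := by
  simp only [l2Form_eq_integral_sliceMap j, sliceMap_lift]

theorem IsSkew.lift {T : Test d k →L[ℂ] Test d k} (hT : IsSkew T) (j : Fin k ↪ Fin N) :
    IsSkew (lift j T) := fun F G => by
  rw [l2Form_lift, l2Form_eq_integral_sliceMap j]
  simp only [sliceMap_lift, hT _ _, MeasureTheory.integral_neg]

theorem insert_trans (e : Fin k ↪ Fin N) (a : Fin l ↪ Fin k) (x : Config d N) (y : Config d l) :
    insert (a.trans e) x y = insert e x (insert a (x ∘ e) y) := by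
  funext n
  by_cases hn : n ∈ Set.range e
  · obtain ⟨i, rfl⟩ := hn
    rw [insert_apply_self]
    by_cases hi : i ∈ Set.range a
    · obtain ⟨m, rfl⟩ := hi
      rw [insert_apply_self]
      exact insert_apply_self (a.trans e) x y m
    · rw [insert_apply_of_notMem _ _ _ hi, insert_apply_of_notMem, Function.comp_apply]
      rintro ⟨m, hm⟩
      exact hi ⟨m, e.injective hm⟩
  · rw [insert_apply_of_notMem _ _ _ hn, insert_apply_of_notMem]
    rintro ⟨m, rfl⟩
    exact hn ⟨a m, rfl⟩

theorem lift_lift (e : Fin k ↪ Fin N) (a : Fin l ↪ Fin k) (T : Test d l →L[ℂ] Test d l) :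
    lift e (lift a T) = lift (a.trans e) T := by
  ext F x
  have h : sliceMap a (rest a (x ∘ e)) (sliceMap e (rest e x) F) =
      sliceMap (a.trans e) (rest (a.trans e) x) F := by
    ext y
    simp only [sliceMap_rest_apply, insert_trans]
  rw [lift_apply, lift_apply, lift_apply, h]
  rfl

end Lift

section Symmetrize

variable {d k l m N : ℕ}

/-- The function `x ↦ F (x_{σ(1)}, …, x_{σ(N)})`. -/
def permute (σ : Equiv.Perm (Fin N)) : Test d N →L[ℂ] Test d N :=
  SchwartzMap.compCLMOfContinuousLinearEquiv ℂ
    (ContinuousLinearEquiv.piCongrLeft ℝ (fun _ => EuclideanSpace ℝ (Fin d)) σ).symm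

theorem permute_apply (σ : Equiv.Perm (Fin N)) (F : Test d N) (x : Config d N) :
    permute σ F x = F (x ∘ σ) := rfl

theorem mem_bosonic_iff {F : Test d N} : F ∈ bosonic d N ↔ ∀ σ, permute σ F = F :=
  ⟨fun h σ => SchwartzMap.ext (h σ), fun h σ => DFunLike.congr_fun (h σ)⟩

theorem permute_coe (σ : Equiv.Perm (Fin N)) (f : Bosonic d N) : permute σ f.1 = f.1 :=
  mem_bosonic_iff.1 f.2 σ

theorem l2Form_permute (σ : Equiv.Perm (Fin N)) (F G : Test d N) :
    l2Form (permute σ F) (permute σ G) = l2Form F G := by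
  rw [l2Form_apply, l2Form_apply]
  exact (MeasureTheory.volume_measurePreserving_piCongrLeft
    (fun _ : Fin N => EuclideanSpace ℝ (Fin d)) σ).symm.integral_comp'
      (g := fun x => (starRingEnd ℂ) (F x) * G x)

theorem l2Form_coe_permute (σ : Equiv.Perm (Fin N)) (f : Bosonic d N) (G : Test d N) :
    l2Form f.1 (permute σ G) = l2Form f.1 G := by
  rw [← l2Form_permute σ f.1 G, permute_coe]

theorem insert_smul_comp (j : Fin k ↪ Fin N) (σ : Equiv.Perm (Fin N)) (x : Config d N)
    (y : Config d k) : insert (σ • j) x y ∘ σ = insert j (x ∘ σ) y := by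
  funext n
  by_cases hn : n ∈ Set.range j
  · obtain ⟨i, rfl⟩ := hn
    exact (insert_apply_self (σ • j) x y i).trans (insert_apply_self j _ y i).symm
  · rw [Function.comp_apply, insert_apply_of_notMem _ _ _ hn, insert_apply_of_notMem]
    · rfl
    · rintro ⟨i, hi⟩
      exact hn ⟨i, σ.injective hi⟩

theorem permute_lift (σ : Equiv.Perm (Fin N)) (j : Fin k ↪ Fin N) (T : Test d k →L[ℂ] Test d k)
    (F : Test d N) : permute σ (lift j T F) = lift (σ • j) T (permute σ F) := by
  ext x
  have h : sliceMap j (rest j (x ∘ σ)) F =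
      sliceMap (σ • j) (rest (σ • j) x) (permute σ F) := by
    ext y
    rw [sliceMap_rest_apply, sliceMap_rest_apply, permute_apply, insert_smul_comp]
  rw [permute_apply, lift_apply, lift_apply, h]
  rfl

/-- The orthogonal projection of a Schwartz function to the bosonic ones. -/
def symmetrize (d N : ℕ) : Test d N →L[ℂ] Bosonic d N :=
  ((N.factorial : ℂ)⁻¹ • ∑ σ : Equiv.Perm (Fin N), permute σ).codRestrict (bosonic d N)
    fun F => by
      rw [smul_apply, sum_apply]
      refine (bosonic d N).smul_mem _ (mem_bosonic_iff.2 fun τ => ?_)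
      rw [map_sum]
      exact Fintype.sum_equiv (Equiv.mulLeft τ) _ _ fun σ => rfl

theorem symmetrize_val (F : Test d N) :
    (symmetrize d N F).1 = (N.factorial : ℂ)⁻¹ • ∑ σ : Equiv.Perm (Fin N), permute σ F := by
  change ((N.factorial : ℂ)⁻¹ • ∑ σ : Equiv.Perm (Fin N), permute σ : _ →L[ℂ] _) F = _
  rw [smul_apply, sum_apply]

theorem inv_factorial_smul_sum_perm {M : Type*} [AddCommGroup M] [Module ℂ M] (v : M) :
    (N.factorial : ℂ)⁻¹ • ∑ _σ : Equiv.Perm (Fin N), v = v := by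
  rw [Finset.sum_const, Finset.card_univ, Fintype.card_perm, Fintype.card_fin,
    ← Nat.cast_smul_eq_nsmul ℂ, inv_smul_smul₀ (Nat.cast_ne_zero.2 N.factorial_ne_zero)]

theorem symmetrize_coe (f : Bosonic d N) : symmetrize d N f.1 = f := by
  apply Subtype.ext
  simp only [symmetrize_val, permute_coe, inv_factorial_smul_sum_perm]

theorem l2Inner_eq_l2Form (f g : Bosonic d N) : l2Inner f g = l2Form f.1 g.1 :=
  (l2Form_apply _ _).symm

theorem l2Inner_symmetrize_right (f : Bosonic d N) (G : Test d N) :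
    l2Inner f (symmetrize d N G) = l2Form f.1 G := by
  simp only [l2Inner_eq_l2Form, symmetrize_val, map_smul, map_sum, l2Form_coe_permute,
    inv_factorial_smul_sum_perm]

theorem l2Inner_symmetrize_left (F : Test d N) (g : Bosonic d N) :
    l2Inner (symmetrize d N F) g = l2Form F g.1 := by
  rw [l2Inner_eq_l2Form, ← l2Form_conj_symm, ← l2Inner_eq_l2Form, l2Inner_symmetrize_right,
    l2Form_conj_symm]

theorem eq_of_forall_l2Inner {f g : Bosonic d N} (h : ∀ u, l2Inner u f = l2Inner u g) : f = g := by
  rw [← sub_eq_zero, ← Submodule.coe_eq_zero]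
  apply eq_zero_of_l2Form_self
  rw [Submodule.coe_sub, map_sub, ← Submodule.coe_sub, ← l2Inner_eq_l2Form, ← l2Inner_eq_l2Form,
    h, sub_self]

end Symmetrize

namespace Observable

variable {d k N : ℕ}

/-- The matrix element `⟨f, A g⟩` of an observable `A`. -/
def matrixElement (f g : Bosonic d k) : Observable d k →ₗ[ℝ] ℂ where
  toFun A := l2Inner f (A.op g)
  map_add' A B := l2Inner_add_right f (A.op g) (B.op g)
  map_smul' c A := (l2Inner_real_smul_right c f (A.op g)).trans (Complex.real_smul).symm

theorem matrixElement_apply (f g : Bosonic d k) (A : Observable d k) :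
    matrixElement f g A = l2Inner f (A.op g) := rfl

theorem lie_op (A B : Observable d N) (f : Bosonic d N) :
    (A.lie B).op f = (N : ℝ) • (A.op (B.op f) - B.op (A.op f)) := rfl

theorem ext_of_op {A B : Observable d k} (h : ∀ g, A.op g = B.op g) : A = B :=
  Subtype.ext (ContinuousLinearMap.ext h)

theorem ext_of_matrixElement {A B : Observable d k}
    (h : ∀ f g, matrixElement f g A = matrixElement f g B) : A = B :=
  ext_of_op fun g => eq_of_forall_l2Inner fun f => h f g

/-- The observable obtained by compressing a skew-adjoint operator to the bosonic functions. -/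
def ofSkew (T : Test d k →L[ℂ] Test d k) (hT : IsSkew T) : Observable d k :=
  ⟨symmetrize d k ∘L T ∘L (bosonic d k).subtypeL, fun _ _ =>
    (l2Inner_symmetrize_left _ _).trans
      ((hT _ _).trans (congrArg _ (l2Inner_symmetrize_right _ _).symm))⟩

theorem matrixElement_ofSkew {T : Test d k →L[ℂ] Test d k} (hT : IsSkew T) (f g : Bosonic d k) :
    matrixElement f g (ofSkew T hT) = l2Form f.1 (T g.1) :=
  l2Inner_symmetrize_right f _

/-- The operator of an observable extended to all Schwartz functions, by `0` on the orthogonal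
complement of the bosonic ones. -/
def extend (A : Observable d k) : Test d k →L[ℂ] Test d k :=
  (bosonic d k).subtypeL ∘L A.op ∘L symmetrize d k

theorem extend_apply (A : Observable d k) (F : Test d k) :
    A.extend F = (A.op (symmetrize d k F)).1 := rfl

theorem extend_coe (A : Observable d k) (f : Bosonic d k) : A.extend f.1 = (A.op f).1 := by
  rw [extend_apply, symmetrize_coe]

theorem l2Form_extend (A : Observable d k) (F G : Test d k) :
    l2Form F (A.extend G) = matrixElement (symmetrize d k F) (symmetrize d k G) A :=
  (l2Inner_symmetrize_left F _).symm

theorem isSkew_extend (A : Observable d k) : IsSkew A.extend := fun F G =>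
  (l2Inner_symmetrize_right _ G).symm.trans <|
    (A.skew _ _).trans (congrArg _ (A.l2Form_extend F G).symm)

theorem extension_eq_lift (A : Observable d k) (j : Fin k ↪ Fin N) (f : Bosonic d N)
    (x : Config d N) : extension A j f x = lift j A.extend f.1 x := by
  rw [lift_apply, ← slice_val, A.extend_coe]
  rfl

end Observable

section Embed

variable {d k l m N : ℕ}

theorem l2Form_lift_eq (i j : Fin k ↪ Fin N) (T : Test d k →L[ℂ] Test d k) (f g : Bosonic d N) :
    l2Form f.1 (lift i T g.1) = l2Form f.1 (lift j T g.1) := by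
  have := Equiv.Perm.isMultiplyPretransitive (Fin N) k
  obtain ⟨σ, rfl⟩ := MulAction.exists_smul_eq (Equiv.Perm (Fin N)) i j
  rw [← l2Form_coe_permute σ f (lift i T g.1), permute_lift, permute_coe]

theorem sum_lift_mem_bosonic (T : Test d k →L[ℂ] Test d k) (f : Bosonic d N) :
    ∑ j : Fin k ↪ Fin N, lift j T f.1 ∈ bosonic d N :=
  mem_bosonic_iff.2 fun σ => by
    simp only [map_sum, permute_lift, permute_coe]
    exact Equiv.sum_comp (MulAction.toPerm σ) fun j : Fin k ↪ Fin N => lift j T f.1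

theorem card_embedding_fin : Fintype.card (Fin k ↪ Fin N) = k.factorial * N.choose k := by
  rw [Fintype.card_embedding_eq, Fintype.card_fin, Fintype.card_fin,
    Nat.descFactorial_eq_factorial_mul_choose]

theorem symmetrize_lift (e : Fin k ↪ Fin N) (T : Test d k →L[ℂ] Test d k) (f : Bosonic d N) :
    (symmetrize d N (lift e T f.1)).1 =
      ((k.factorial * N.choose k : ℕ) : ℂ)⁻¹ • ∑ j : Fin k ↪ Fin N, lift j T f.1 := by
  have hM : (Fintype.card (Fin k ↪ Fin N) : ℂ) ≠ 0 :=
    Nat.cast_ne_zero.2 (Fintype.card_pos_iff.2 ⟨e⟩).ne'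
  have h : symmetrize d N (lift e T f.1) = ((k.factorial * N.choose k : ℕ) : ℂ)⁻¹ •
      (⟨∑ j : Fin k ↪ Fin N, lift j T f.1, sum_lift_mem_bosonic T f⟩ : Bosonic d N) := by
    refine eq_of_forall_l2Inner fun u => ?_
    rw [l2Inner_symmetrize_right, l2Inner_smul_right, l2Inner_eq_l2Form, map_sum]
    simp only [l2Form_lift_eq _ e]
    rw [Finset.sum_const, Finset.card_univ, nsmul_eq_mul, ← card_embedding_fin,
      inv_mul_cancel_left₀ hM]
  rw [h, Submodule.coe_smul]

theorem isEmbedded_ofSkew_lift (e : Fin k ↪ Fin N) (A : Observable d k) :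
    IsEmbedded A
      (.ofSkew (lift e A.extend) (A.isSkew_extend.lift e) : Observable d N) := fun f x => by
  change (symmetrize d N (lift e A.extend f.1)).1 x = _
  simp only [A.extension_eq_lift, symmetrize_lift, smul_apply, sum_apply, smul_eq_mul]

theorem isEmbedded_embed (hkN : k ≤ N) (A : Observable d k) : IsEmbedded A (embed N A) := by
  have h : ∃ E : Observable d N, IsEmbedded A E := ⟨_, isEmbedded_ofSkew_lift (Fin.castLEEmb hkN) A⟩
  rw [embed, dif_pos h]
  exact h.choose_spec

theorem embed_eq_ofSkew_lift (e : Fin k ↪ Fin N) (A : Observable d k) :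
    embed N A = .ofSkew (lift e A.extend) (A.isSkew_extend.lift e) := by
  have hkN : k ≤ N := by simpa using Fintype.card_le_of_embedding e
  refine Observable.ext_of_op fun f => Subtype.ext (SchwartzMap.ext fun x => ?_)
  exact (isEmbedded_embed hkN A f x).trans (isEmbedded_ofSkew_lift e A f x).symm

theorem matrixElement_embed (e : Fin k ↪ Fin N) (A : Observable d k) (f g : Bosonic d N) :
    Observable.matrixElement f g (embed N A) = l2Form f.1 (lift e A.extend g.1) := by
  rw [embed_eq_ofSkew_lift e, Observable.matrixElement_ofSkew]

theorem embed_op_val (hkN : k ≤ N) (A : Observable d k) (f : Bosonic d N) :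
    ((embed N A).op f).1 =
      ((k.factorial * N.choose k : ℕ) : ℂ)⁻¹ • ∑ j : Fin k ↪ Fin N, lift j A.extend f.1 := by
  rw [embed_eq_ofSkew_lift (Fin.castLEEmb hkN), ← symmetrize_lift (Fin.castLEEmb hkN)]
  rfl

theorem embed_add (hkN : k ≤ N) (A B : Observable d k) :
    embed N (A + B) = embed N A + embed N B := by
  refine Observable.ext_of_op fun f => Subtype.ext (SchwartzMap.ext fun x => ?_)
  have h (j : Fin k ↪ Fin N) :
      extension (A + B) j f x = extension A j f x + extension B j f x := rfl
  change _ = ((embed N A).op f).1 x + ((embed N B).op f).1 x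
  rw [isEmbedded_embed hkN, isEmbedded_embed hkN, isEmbedded_embed hkN]
  simp only [h, Finset.sum_add_distrib, mul_add]

theorem embed_smul (hkN : k ≤ N) (c : ℝ) (A : Observable d k) :
    embed N (c • A) = c • embed N A := by
  refine Observable.ext_of_op fun f => Subtype.ext (SchwartzMap.ext fun x => ?_)
  have h (j : Fin k ↪ Fin N) : extension (c • A) j f x = c • extension A j f x := rfl
  change _ = c • ((embed N A).op f).1 x
  rw [isEmbedded_embed hkN, isEmbedded_embed hkN]
  simp only [h, ← Finset.smul_sum, mul_smul_comm]

/-- The embedding `ε_{k,N}` as a linear map. -/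
def embedₗ (hkN : k ≤ N) : Observable d k →ₗ[ℝ] Observable d N where
  toFun := embed N
  map_add' := embed_add hkN
  map_smul' := embed_smul hkN

theorem embed_sum (hkN : k ≤ N) {ι : Type*} (s : Finset ι) (A : ι → Observable d k) :
    embed N (∑ i ∈ s, A i) = ∑ i ∈ s, embed N (A i) :=
  map_sum (embedₗ hkN) A s

theorem l2Form_ofSkew_extend {T : Test d k →L[ℂ] Test d k} (hT : IsSkew T) (f g : Bosonic d k) :
    l2Form f.1 ((Observable.ofSkew T hT).extend g.1) = l2Form f.1 (T g.1) := by
  rw [Observable.l2Form_extend, symmetrize_coe, symmetrize_coe, Observable.matrixElement_ofSkew]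

theorem embed_ofSkew (e : Fin m ↪ Fin N) {T : Test d m →L[ℂ] Test d m} (hT : IsSkew T) :
    embed N (.ofSkew T hT : Observable d m) = .ofSkew (lift e T) (hT.lift e) :=
  Observable.ext_of_matrixElement fun f g => by
    rw [matrixElement_embed e, Observable.matrixElement_ofSkew, l2Form_lift, l2Form_lift]
    exact congrArg _ (funext fun z => l2Form_ofSkew_extend hT
      ⟨_, sliceMap_mem_bosonic e z f⟩ ⟨_, sliceMap_mem_bosonic e z g⟩)

end Embed

section Commutator

variable {d k l m N : ℕ}

/-- The contribution `[A_i, B_j]` of the tuples `i`, `j` to a commutator of embedded observables. -/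
def pairComm (i : Fin k ↪ Fin N) (j : Fin l ↪ Fin N) (A : Observable d k) (B : Observable d l) :
    Observable d N :=
  .ofSkew ⁅lift i A.extend, lift j B.extend⁆ ((A.isSkew_extend.lift i).lie (B.isSkew_extend.lift j))

theorem matrixElement_pairComm (i : Fin k ↪ Fin N) (j : Fin l ↪ Fin N) (A : Observable d k)
    (B : Observable d l) (f g : Bosonic d N) :
    Observable.matrixElement f g (pairComm i j A B) =
      l2Form f.1 (lift i A.extend (lift j B.extend g.1)) -
        l2Form f.1 (lift j B.extend (lift i A.extend g.1)) :=
  (Observable.matrixElement_ofSkew _ f g).trans (map_sub (l2Form f.1) _ _)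

theorem embed_pairComm (e : Fin m ↪ Fin N) (a : Fin k ↪ Fin m) (b : Fin l ↪ Fin m)
    (A : Observable d k) (B : Observable d l) :
    embed N (pairComm a b A B) = pairComm (a.trans e) (b.trans e) A B := by
  simp only [pairComm, embed_ofSkew e, lift_lie, lift_lift]

theorem matrixElement_lie (A B : Observable d N) (f g : Bosonic d N) :
    Observable.matrixElement f g (A.lie B) =
      N * (l2Inner f (A.op (B.op g)) - l2Inner f (B.op (A.op g))) := by
  rw [Observable.matrixElement_apply, Observable.lie_op, l2Inner_real_smul_right, l2Inner_eq_l2Form,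
    Submodule.coe_sub, map_sub, l2Inner_eq_l2Form, l2Inner_eq_l2Form, Complex.ofReal_natCast]

theorem l2Inner_embed_op_embed_op (hk : k ≤ N) (hl : l ≤ N) (A : Observable d k)
    (B : Observable d l) (f g : Bosonic d N) :
    l2Inner f ((embed N A).op ((embed N B).op g)) =
      ((k.factorial * N.choose k : ℕ) : ℂ)⁻¹ * (((l.factorial * N.choose l : ℕ) : ℂ)⁻¹ *
        ∑ i : Fin k ↪ Fin N, ∑ j : Fin l ↪ Fin N,
          l2Form f.1 (lift i A.extend (lift j B.extend g.1))) := by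
  rw [l2Inner_eq_l2Form, embed_op_val hk, embed_op_val hl]
  simp only [map_smul, map_sum, smul_eq_mul, Finset.mul_sum]

theorem lie_embed_embed_eq_sum (hk : k ≤ N) (hl : l ≤ N) (A : Observable d k)
    (B : Observable d l) :
    (embed N A).lie (embed N B) =
      ((N : ℝ) * ((k.factorial * N.choose k : ℕ) : ℝ)⁻¹ *
          ((l.factorial * N.choose l : ℕ) : ℝ)⁻¹) •
        ∑ i : Fin k ↪ Fin N, ∑ j : Fin l ↪ Fin N, pairComm i j A B := by
  refine Observable.ext_of_matrixElement fun f g => ?_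
  rw [matrixElement_lie, l2Inner_embed_op_embed_op hk hl, l2Inner_embed_op_embed_op hl hk,
    map_smul, Complex.real_smul]
  simp only [map_sum, matrixElement_pairComm, Finset.sum_sub_distrib]
  rw [Finset.sum_comm (f := fun (j : Fin l ↪ Fin N) (i : Fin k ↪ Fin N) =>
    l2Form f.1 (lift j B.extend (lift i A.extend g.1)))]
  push_cast
  ring

theorem exists_trans_eq_of_range_subset {ι κ α : Type*} {i : ι ↪ α} {e : κ ↪ α}
    (h : Set.range i ⊆ Set.range e) : ∃ a : ι ↪ κ, a.trans e = i := by
  choose a ha using fun x => h ⟨x, rfl⟩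
  exact ⟨⟨a, fun x y hxy => i.injective (by rw [← ha, ← ha, hxy])⟩, DFunLike.ext _ _ ha⟩

theorem exists_common_extension (hm : min (k + l - 1) N ≤ m) (hmN : m ≤ N) {i : Fin k ↪ Fin N}
    {j : Fin l ↪ Fin N} (hij : ¬Disjoint (Set.range i) (Set.range j)) :
    ∃ (e : Fin m ↪ Fin N) (a : Fin k ↪ Fin m) (b : Fin l ↪ Fin m),
      a.trans e = i ∧ b.trans e = j := by
  classical
  have hinter : 0 < (Finset.univ.map i ∩ Finset.univ.map j).card := by
    rw [Finset.card_pos]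
    obtain ⟨n, hi, hj⟩ := Set.not_disjoint_iff.1 hij
    exact ⟨n, by simpa using ⟨hi, hj⟩⟩
  have hcard : (Finset.univ.map i ∪ Finset.univ.map j).card ≤ m := by
    have h := Finset.card_union_add_card_inter (Finset.univ.map i) (Finset.univ.map j)
    have hN := Finset.card_le_univ (Finset.univ.map i ∪ Finset.univ.map j)
    simp only [Finset.card_map, Finset.card_univ, Fintype.card_fin] at h hN
    omega
  obtain ⟨V, hUV, hV⟩ := Finset.exists_superset_card_eq hcard (by simpa using hmN)
  have hrange : Set.range (V.orderEmbOfFin hV).toEmbedding = V := V.range_orderEmbOfFin hV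
  have himage (f : Finset (Fin N)) (hf : f ⊆ V) :
      (f : Set (Fin N)) ⊆ Set.range (V.orderEmbOfFin hV).toEmbedding := hrange ▸ hf
  obtain ⟨a, ha⟩ := exists_trans_eq_of_range_subset (i := i) (e := (V.orderEmbOfFin hV).toEmbedding)
    (by simpa using himage _ (Finset.subset_union_left.trans hUV))
  obtain ⟨b, hb⟩ := exists_trans_eq_of_range_subset (i := j) (e := (V.orderEmbOfFin hV).toEmbedding)
    (by simpa using himage _ (Finset.subset_union_right.trans hUV))
  exact ⟨_, a, b, ha, hb⟩

end Commutator

section Polarization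

variable {ι R M M' : Type*} [Fintype ι] [CommRing R] [AddCommGroup M] [AddCommGroup M']
  [Module R M] [Module R M']

theorem sum_subsets_neg_one_pow_card_compl [DecidableEq ι] (s : Finset ι) :
    ∑ U : Finset ι with s ⊆ U, (-1 : R) ^ Uᶜ.card = if s = Finset.univ then 1 else 0 := by
  have h := congrArg (Int.cast : ℤ → R) (Finset.sum_powerset_neg_one_pow_card (x := sᶜ))
  push_cast [Finset.compl_eq_empty_iff] at h
  rw [← h]
  refine Finset.sum_equiv (OrderIso.compl (Finset ι)).toEquiv (fun U => ?_) fun U _ => rfl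
  rw [Finset.mem_filter, Finset.mem_powerset]
  exact (and_iff_right (Finset.mem_univ _)).trans
    (Finset.compl_subset_compl (s := U) (t := s)).symm

/-- Polarization, as inclusion-exclusion over the set of indices that a map `ι → ι` hits. -/
theorem sum_perm_multilinear [DecidableEq ι] (f : MultilinearMap R (fun _ : ι => M) M')
    (v : ι → M) : ∑ σ : Equiv.Perm ι, f (v ∘ σ) =
      ∑ U : Finset ι, (-1 : R) ^ Uᶜ.card • f fun _ => ∑ i ∈ U, v i := by
  have expand (U : Finset ι) : (f fun _ => ∑ i ∈ U, v i) =
      ∑ φ : ι → ι with Finset.univ.image φ ⊆ U, f (v ∘ φ) := by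
    rw [f.map_sum_finset (fun _ i => v i) fun _ => U]
    refine Finset.sum_congr (Finset.ext fun φ => ?_) fun _ _ => rfl
    simp [Finset.subset_iff]
  have hits (φ : ι → ι) : Finset.univ.image φ = Finset.univ ↔ Function.Bijective φ := by
    rw [← Finset.coe_eq_univ, Finset.coe_image, Finset.coe_univ, Set.image_univ,
      Set.range_eq_univ, ← Finite.surjective_iff_bijective]
  symm
  calc ∑ U : Finset ι, (-1 : R) ^ Uᶜ.card • f (fun _ => ∑ i ∈ U, v i)
      = ∑ φ : ι → ι, (∑ U : Finset ι with Finset.univ.image φ ⊆ U, (-1 : R) ^ Uᶜ.card) •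
          f (v ∘ φ) := by
        simp only [expand, Finset.smul_sum, Finset.sum_smul]
        exact Finset.sum_comm' (by simp)
    _ = ∑ φ : ι → ι with Function.Bijective φ, f (v ∘ φ) := by
        simp only [sum_subsets_neg_one_pow_card_compl, hits, ite_smul, one_smul, zero_smul]
        exact (Finset.sum_filter _ _).symm
    _ = ∑ σ : Equiv.Perm ι, f (v ∘ σ) :=
        (Finset.sum_bij (fun (σ : Equiv.Perm ι) _ => (σ : ι → ι))
          (fun σ _ => by simp) (fun _ _ _ _ h => DFunLike.coe_injective h)
          (fun φ hφ => ⟨.ofBijective φ (by simpa using hφ), Finset.mem_univ _, rfl⟩)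
          fun _ _ => rfl).symm

theorem multilinear_add_smul (f : MultilinearMap R (fun _ : ι => M) M') (u v : ι → M) (t : R) :
    f (u + t • v) =
      open Classical in ∑ s : Finset ι, t ^ s.card • f (s.piecewise v u) := by
  classical
  rw [add_comm, f.map_add_univ]
  refine Finset.sum_congr rfl fun s _ => ?_
  rw [← Finset.prod_const, ← f.map_piecewise_smul (fun _ => t)]
  congr 1
  funext i
  by_cases hi : i ∈ s <;> simp [hi]

end Polarization

section Tensor

variable {d k l N : ℕ}

/-- The compactly supported smooth functions of one particle. -/
def compactlySupported (d : ℕ) : Submodule ℂ 𝓢(EuclideanSpace ℝ (Fin d), ℂ) where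
  carrier := {p | HasCompactSupport p}
  zero_mem' := HasCompactSupport.zero
  add_mem' hp hq := hp.add hq
  smul_mem' c _ hp := hp.smul_left (f := fun _ => c)

theorem hasCompactSupport_prod {ι X : Type*} [Fintype ι] [TopologicalSpace X] [R1Space X]
    {p : ι → X → ℂ} (hp : ∀ n, HasCompactSupport (p n)) :
    HasCompactSupport fun x : ι → X => ∏ n, p n (x n) :=
  .intro (isCompact_univ_pi hp) fun x hx => by
    simp only [Set.mem_pi, Set.mem_univ, true_implies, not_forall] at hx
    obtain ⟨n, hn⟩ := hx
    exact Finset.prod_eq_zero (Finset.mem_univ n) (image_eq_zero_of_notMem_tsupport hn)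

/-- The tensor product `p_1(x_1) ⋯ p_N(x_N)` of one-particle functions. -/
def tensor : MultilinearMap ℂ (fun _ : Fin N => compactlySupported d) (Test d N) :=
  let value (x : Config d N) : MultilinearMap ℂ (fun _ : Fin N => compactlySupported d) ℂ :=
    (MultilinearMap.mkPiAlgebra ℂ (Fin N) ℂ).compLinearMap fun n =>
      { toFun p := p.1 (x n), map_add' _ _ := rfl, map_smul' _ _ := rfl }
  { toFun p := (hasCompactSupport_prod fun n => (p n).2).toSchwartzMap
      (contDiff_prod fun n _ => ((p n).1.smooth _).comp (contDiff_apply ℝ _ n))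
    map_update_add' p n q r := SchwartzMap.ext fun x => (value x).map_update_add p n q r
    map_update_smul' p n c q := SchwartzMap.ext fun x => (value x).map_update_smul p n c q }

theorem tensor_apply (p : Fin N → compactlySupported d) (x : Config d N) :
    tensor p x = ∏ n, (p n).1 (x n) := rfl

theorem permute_tensor (σ : Equiv.Perm (Fin N)) (p : Fin N → compactlySupported d) :
    permute σ (tensor (p ∘ σ)) = tensor p := by
  ext x
  exact Equiv.prod_comp σ fun n => (p n).1 (x n)

theorem exists_bump (a : EuclideanSpace ℝ (Fin d)) {ε : ℝ} (hε : 0 < ε) :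
    ∃ (p : compactlySupported d) (b : EuclideanSpace ℝ (Fin d) → ℝ),
      (∀ y, p.1 y = b y) ∧ 0 ≤ b ∧ 0 < b a ∧ b.support ⊆ Metric.ball a ε := by
  let b : ContDiffBump a := ⟨ε / 2, ε, half_pos hε, half_lt_self hε⟩
  have hb : HasCompactSupport fun y => (b y : ℂ) :=
    b.hasCompactSupport.comp_left Complex.ofReal_zero
  exact ⟨⟨hb.toSchwartzMap (Complex.ofRealCLM.contDiff.comp b.contDiff), hb⟩, b, fun _ => rfl,
    fun _ => b.nonneg, b.pos_of_mem_ball (Metric.mem_ball_self hε), b.support_eq.subset⟩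

theorem exists_tensor_bump (a : Config d N) {ε : ℝ} (hε : 0 < ε) :
    ∃ (p : Fin N → compactlySupported d) (b : Config d N → ℝ),
      (∀ x, tensor p x = b x) ∧ 0 ≤ b ∧ 0 < b a ∧ b.support ⊆ Metric.ball a ε := by
  choose p b hpb hb0 hba hbε using fun n => exists_bump (a n) hε
  refine ⟨p, fun x => ∏ n, b n (x n), fun x => ?_, fun x => Finset.prod_nonneg fun n _ => hb0 n _,
    Finset.prod_pos fun n _ => hba n, fun x hx => ?_⟩
  · simp only [tensor_apply, hpb, Complex.ofReal_prod]
  · rw [ball_pi a hε]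
    exact fun n _ => hbε n (Finset.prod_ne_zero_iff.1 hx n (Finset.mem_univ n))

theorem eq_zero_of_l2Form_tensor {H : Test d N} (h : ∀ p, l2Form (tensor p) H = 0) : H = 0 := by
  by_contra! hH
  obtain ⟨a, ha⟩ := DFunLike.ne_iff.1 hH
  let g : Config d N → ℝ := fun x => ((starRingEnd ℂ) (H a) * H x).re
  have hg : Continuous g := Complex.continuous_re.comp (continuous_const.mul H.continuous)
  have hga : 0 < g a := by
    simp only [g, ← Complex.normSq_eq_conj_mul_self, Complex.ofReal_re]
    exact Complex.normSq_pos.2 ha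
  obtain ⟨ε, hε, hball⟩ := Metric.isOpen_iff.1 (isOpen_Ioi.preimage hg) a hga
  obtain ⟨p, b, hpb, hb0, hba, hbε⟩ := exists_tensor_bump a hε
  have hb : Continuous b :=
    (Complex.continuous_re.comp (tensor p).continuous).congr fun x => by simp [hpb]
  have hbs : HasCompactSupport b := .intro (isCompact_closedBall a ε) fun x hx =>
    Function.notMem_support.1 fun hx' => hx (Metric.ball_subset_closedBall (hbε hx'))
  have hbg : 0 ≤ b * g := fun x => by
    by_cases hx : x ∈ b.support
    · exact mul_nonneg (hb0 x) (hball (hbε hx)).le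
    · simp [Function.notMem_support.1 hx]
  have hpos : 0 < ∫ x, b x * g x :=
    (hb.mul hg).integral_pos_of_hasCompactSupport_nonneg_nonzero (x := a) hbs.mul_right hbg
      (mul_pos hba hga).ne'
  have hint : ∫ x, b x * g x = ((starRingEnd ℂ) (H a) * l2Form (tensor p) H).re := by
    rw [l2Form_apply, ← MeasureTheory.integral_const_mul, ← RCLike.re_eq_complex_re,
      ← integral_re ((integrable_conj_mul _ _).const_mul _)]
    simp only [hpb, Complex.conj_ofReal, mul_left_comm _ (b _ : ℂ), RCLike.re_eq_complex_re,
      Complex.re_ofReal_mul, g]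
  rw [hint, h p, mul_zero, Complex.zero_re] at hpos
  exact lt_irrefl _ hpos

/-- The bosonic function `p ⊗ ⋯ ⊗ p`. -/
def power (N : ℕ) (p : compactlySupported d) : Bosonic d N :=
  ⟨tensor fun _ => p, mem_bosonic_iff.2 fun σ => permute_tensor σ fun _ => p⟩

theorem power_val (p : compactlySupported d) : (power N p).1 = tensor fun _ => p := rfl

theorem power_zero (hN : 1 ≤ N) : power (d := d) N 0 = 0 :=
  Subtype.ext ((tensor (d := d) (N := N)).map_coord_zero ⟨0, hN⟩ rfl)

theorem eq_zero_of_l2Inner_power {f : Bosonic d N} (h : ∀ p, l2Inner (power N p) f = 0) :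
    f = 0 := by
  simp only [l2Inner_eq_l2Form, power_val] at h
  refine Subtype.ext (eq_zero_of_l2Form_tensor fun p => ?_)
  have hsum : l2Form (∑ σ : Equiv.Perm (Fin N), tensor (p ∘ σ)) f.1 = 0 := by
    simp only [sum_perm_multilinear, map_sum, LinearMap.sum_apply, map_smulₛₗ,
      LinearMap.smul_apply, h, smul_zero, Finset.sum_const_zero]
  have hterm (σ : Equiv.Perm (Fin N)) : l2Form (tensor (p ∘ σ)) f.1 = l2Form (tensor p) f.1 := by
    rw [← l2Form_permute σ, permute_tensor, permute_coe]
  simpa only [map_sum, LinearMap.sum_apply, hterm, inv_factorial_smul_sum_perm, smul_zero]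
    using congrArg ((N.factorial : ℂ)⁻¹ • ·) hsum

namespace Observable

theorem eq_zero_of_op_power {A : Observable d N} (h : ∀ p, A.op (power N p) = 0) : A = 0 :=
  ext_of_op fun g => eq_zero_of_l2Inner_power fun p => by
    rw [← neg_eq_zero, ← A.skew, h, l2Inner_eq_l2Form, Submodule.coe_zero, map_zero,
      LinearMap.zero_apply]

theorem eq_zero_of_matrixElement_power {A : Observable d N}
    (h : ∀ p q, matrixElement (power N q) (power N p) A = 0) : A = 0 :=
  eq_zero_of_op_power fun p => eq_zero_of_l2Inner_power (h p)

end Observable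

theorem prod_rest_mul_prod {M : Type*} [CommMonoid M] (j : Fin k ↪ Fin N) (u : Fin N → M) :
    (∏ a : Rest j, u a) * ∏ i, u (j i) = ∏ n, u n := by
  rw [← (restSumEquiv j).prod_comp, Fintype.prod_sum_type]
  rfl

theorem prod_rest_eq {M : Type*} [CommMonoid M] (j : Fin k ↪ Fin N) (u : Fin N → M) :
    ∏ a : Rest j, u a = open Classical in ∏ n, if n ∈ Set.range j then 1 else u n := by
  classical
  rw [← prod_rest_mul_prod j]
  simp only [Set.mem_range_self, if_true, Finset.prod_const_one, mul_one]
  exact Fintype.prod_congr _ _ fun a => (if_neg a.2).symm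

theorem sliceMap_tensor (j : Fin k ↪ Fin N) (z : RestConfig d j)
    (p : Fin N → compactlySupported d) :
    sliceMap j z (tensor p) = (∏ a : Rest j, (p a).1 (z a)) • tensor (p ∘ j) := by
  ext y
  obtain ⟨hz, hy⟩ := Prod.ext_iff.1 ((split j).apply_symm_apply (z, y))
  rw [split_apply] at hz hy
  rw [sliceMap_apply, tensor_apply, ← prod_rest_mul_prod j]
  exact congrArg₂ (fun (z : RestConfig d j) (y : Config d k) =>
    (∏ a : Rest j, (p a).1 (z a)) * ∏ i, (p (j i)).1 (y i)) hz hy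

theorem lift_tensor (j : Fin k ↪ Fin N) (T : Test d k →L[ℂ] Test d k)
    (p : Fin N → compactlySupported d) (x : Config d N) :
    lift j T (tensor p) x = (∏ a : Rest j, (p a).1 (x a)) * T (tensor (p ∘ j)) (x ∘ j) := by
  rw [lift_apply, sliceMap_tensor, map_smul, smul_apply, smul_eq_mul]
  rfl

theorem lift_lift_tensor {i : Fin k ↪ Fin N} {j : Fin l ↪ Fin N}
    (hij : Disjoint (Set.range i) (Set.range j)) (S : Test d k →L[ℂ] Test d k)
    (T : Test d l →L[ℂ] Test d l) (p : Fin N → compactlySupported d) (x : Config d N) :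
    lift i S (lift j T (tensor p)) x =
      open Classical in
      (∏ n, if n ∈ Set.range i ∪ Set.range j then 1 else (p n).1 (x n)) *
        T (tensor (p ∘ j)) (x ∘ j) * S (tensor (p ∘ i)) (x ∘ i) := by
  classical
  have hxj (y : Config d k) : insert i x y ∘ j = x ∘ j := funext fun m =>
    insert_apply_of_notMem i x y (hij.notMem_of_mem_right ⟨m, rfl⟩)
  have hprod (y : Config d k) : (∏ a : Rest j, (p a).1 (insert i x y a)) =
      (∏ n, if n ∈ Set.range i ∪ Set.range j then 1 else (p n).1 (x n)) * tensor (p ∘ i) y := by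
    rw [prod_rest_eq j fun n => (p n).1 (insert i x y n), ← prod_rest_mul_prod i]
    simp only [Set.mem_union, ite_or, ← prod_rest_eq i, tensor_apply]
    congr 1
    · exact Fintype.prod_congr _ _ fun a => by rw [insert_apply_of_notMem _ _ _ a.2]
    · exact Fintype.prod_congr _ _ fun m => by
        rw [if_neg (hij.notMem_of_mem_left ⟨m, rfl⟩), insert_apply_self, Function.comp_apply]
  have h : sliceMap i (rest i x) (lift j T (tensor p)) =
      ((∏ n, if n ∈ Set.range i ∪ Set.range j then 1 else (p n).1 (x n)) *
        T (tensor (p ∘ j)) (x ∘ j)) • tensor (p ∘ i) := by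
    ext y
    rw [sliceMap_rest_apply, lift_tensor, hxj, hprod, smul_apply, smul_eq_mul, mul_right_comm]
  rw [lift_apply, h, map_smul, smul_apply, smul_eq_mul]

theorem pairComm_of_disjoint {i : Fin k ↪ Fin N} {j : Fin l ↪ Fin N}
    (hij : Disjoint (Set.range i) (Set.range j)) (A : Observable d k) (B : Observable d l) :
    pairComm i j A B = 0 :=
  Observable.eq_zero_of_op_power fun p => by
    have h : ⁅lift i A.extend, lift j B.extend⁆ (power N p).1 = 0 := by
      refine sub_eq_zero.2 (SchwartzMap.ext fun x => ?_)
      change lift i A.extend (lift j B.extend (power N p).1) x =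
        lift j B.extend (lift i A.extend (power N p).1) x
      simp only [power, lift_lift_tensor hij, lift_lift_tensor hij.symm,
        Set.union_comm (Set.range j)]
      rw [mul_right_comm]
    exact (congrArg (symmetrize d N) h).trans (map_zero _)

end Tensor

section Injectivity

variable {d k N : ℕ}

theorem matrixElement_power_embed (hkN : k ≤ N) (A : Observable d k)
    (p q : compactlySupported d) :
    Observable.matrixElement (power N q) (power N p) (embed N A) =
      l2Form q.1 p.1 ^ (N - k) * Observable.matrixElement (power k q) (power k p) A := by
  let e := Fin.castLEEmb hkN
  have hcard : Fintype.card (Rest e) = N - k := by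
    have := Fintype.card_congr (restSumEquiv e)
    rw [Fintype.card_sum, Fintype.card_fin, Fintype.card_fin] at this
    omega
  have hslice (z : RestConfig d e) (r : compactlySupported d) :
      sliceMap e z (power N r).1 = (∏ a, r.1 (z a)) • (power k r).1 := sliceMap_tensor e z _
  rw [matrixElement_embed e, l2Form_lift, ← hcard, l2Form_apply q.1,
    ← MeasureTheory.integral_fintype_prod_volume_eq_pow, ← MeasureTheory.integral_mul_const]
  simp only [hslice, map_smul, map_smulₛₗ, LinearMap.smul_apply, smul_eq_mul, map_prod,
    Finset.prod_mul_distrib, A.extend_coe, Observable.matrixElement_apply, l2Inner_eq_l2Form]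
  simp only [mul_left_comm, mul_assoc]

theorem continuous_matrixElement_power_add_smul (A : Observable d k)
    (p q : compactlySupported d) :
    Continuous fun t : ℂ => Observable.matrixElement (power k (q + t • p)) (power k p) A := by
  have h (t : ℂ) : (power k (q + t • p)).1 = tensor ((fun _ => q) + t • fun _ => p) := rfl
  simp only [Observable.matrixElement_apply, l2Inner_eq_l2Form, h, multilinear_add_smul, map_sum,
    map_smulₛₗ, LinearMap.sum_apply, LinearMap.smul_apply, smul_eq_mul, map_pow]
  fun_prop

theorem eq_zero_of_embed_eq_zero (hk : 1 ≤ k) (hkN : k ≤ N) {A : Observable d k}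
    (hA : embed N A = 0) : A = 0 := by
  refine Observable.eq_zero_of_matrixElement_power fun p q => ?_
  have of_ne_zero (r : compactlySupported d) (hr : l2Form r.1 p.1 ≠ 0) :
      Observable.matrixElement (power k r) (power k p) A = 0 := by
    have h := matrixElement_power_embed hkN A p r
    rw [hA, map_zero, zero_eq_mul] at h
    exact h.resolve_left (pow_ne_zero _ hr)
  by_cases hp : p = 0
  · rw [hp, power_zero hk, Observable.matrixElement_apply, map_zero, l2Inner_eq_l2Form,
      Submodule.coe_zero, map_zero]
  -- If `⟨q, p⟩ = 0`, perturb `q` to `q + t p` and let `t → 0`.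
  by_cases hqp : l2Form q.1 p.1 = 0
  · have hpp : l2Form p.1 p.1 ≠ 0 := fun h => hp (Subtype.ext (eq_zero_of_l2Form_self h))
    have hpert (t : ℂ) (ht : t ∈ ({0}ᶜ : Set ℂ)) : l2Form (q + t • p).1 p.1 ≠ 0 := by
      simpa [hqp, hpp] using ht
    have h := (continuous_matrixElement_power_add_smul A p q).ext_on (dense_compl_singleton 0)
      continuous_zero fun t ht => of_ne_zero (q + t • p) (hpert t ht)
    simpa using congrFun h 0
  · exact of_ne_zero q hqp

theorem embed_injective (hk : 1 ≤ k) (hkN : k ≤ N) :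
    Function.Injective (embed N : Observable d k → Observable d N) :=
  (injective_iff_map_eq_zero (embedₗ hkN)).2 fun _ => eq_zero_of_embed_eq_zero hk hkN

end Injectivity

section Boundedness

open Bornology

theorem bddAbove_image_of_isVonNBounded {𝕜 E : Type*} [NontriviallyNormedField 𝕜] [AddCommGroup E]
    [Module 𝕜 E] [TopologicalSpace E] {S : Set E} (hS : IsVonNBounded 𝕜 S) {p : Seminorm 𝕜 E}
    (hp : Continuous p) : BddAbove (p '' S) := by
  have hball : p.ball 0 1 ∈ 𝓝 0 := p.ball_mem_nhds hp one_pos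
  obtain ⟨c, hc⟩ := (hS hball).exists
  refine ⟨‖c‖, ?_⟩
  rintro _ ⟨x, hx, rfl⟩
  obtain ⟨y, hy, rfl⟩ := hc hx
  rw [map_smul_eq_mul]
  exact mul_le_of_le_one_right (norm_nonneg c) (p.mem_ball_zero.1 hy).le

variable {𝕜 G E F : Type*} [RCLike 𝕜] [NormedAddCommGroup G] [NormedSpace ℝ G]
  [NormedAddCommGroup E] [NormedSpace ℝ E] [NormedAddCommGroup F] [NormedSpace ℝ F]
  [NormedSpace 𝕜 F] [SMulCommClass ℝ 𝕜 F]

theorem isVonNBounded_weighted_sliceAt {S : Set 𝓢(G × E, F)} (hS : IsVonNBounded 𝕜 S) (c : ℕ) :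
    IsVonNBounded 𝕜
      (Set.image2 (fun g f => (((1 + ‖g‖) ^ c : ℝ) : 𝕜) • sliceAt 𝕜 g f) Set.univ S) := by
  rw [(schwartz_withSeminorms 𝕜 E F).isVonNBounded_iff_seminorm_bddAbove]
  rintro ⟨a, b⟩
  have hp := (schwartz_withSeminorms 𝕜 E F).continuous_seminorm (a, b)
  obtain ⟨q, hq, h⟩ := exists_pow_mul_seminorm_sliceAt_le (G := G) hp 0
  obtain ⟨q', hq', h'⟩ := exists_pow_mul_seminorm_sliceAt_le (G := G) hp c
  obtain ⟨R, hR⟩ := bddAbove_image_of_isVonNBounded (p := q + q') hS (hq.add hq')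
  refine ⟨2 ^ (c - 1) * R, ?_⟩
  rintro _ ⟨_, ⟨g, -, f, hf, rfl⟩, rfl⟩
  rw [map_smul_eq_mul, RCLike.norm_ofReal, abs_of_nonneg (by positivity)]
  calc (1 + ‖g‖) ^ c * schwartzSeminormFamily 𝕜 E F (a, b) (sliceAt 𝕜 g f)
      ≤ 2 ^ (c - 1) * (1 ^ c + ‖g‖ ^ c) *
          schwartzSeminormFamily 𝕜 E F (a, b) (sliceAt 𝕜 g f) := by
        gcongr
        exact add_pow_le zero_le_one (norm_nonneg _) c
    _ = 2 ^ (c - 1) * (‖g‖ ^ 0 * schwartzSeminormFamily 𝕜 E F (a, b) (sliceAt 𝕜 g f) +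
          ‖g‖ ^ c * schwartzSeminormFamily 𝕜 E F (a, b) (sliceAt 𝕜 g f)) := by ring
    _ ≤ 2 ^ (c - 1) * R := by
        gcongr
        exact (add_le_add (h f g) (h' f g)).trans (hR ⟨f, hf, rfl⟩)

end Boundedness

section Topology

open Bornology Filter

variable {d k l m N : ℕ}

/-- Complex conjugation of bosonic functions. -/
def conj : Bosonic d k →L⋆[ℂ] Bosonic d k where
  toFun f := ⟨SchwartzMap.postcompCLM (𝕜 := ℝ) Complex.conjCLE.toContinuousLinearMap f.1,
    fun σ x => congrArg (starRingEnd ℂ) (f.2 σ x)⟩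
  map_add' f g := Subtype.ext (map_add (SchwartzMap.postcompCLM _) f.1 g.1)
  map_smul' c f := Subtype.ext (SchwartzMap.ext fun x => map_mul (starRingEnd ℂ) c (f.1 x))
  cont := by fun_prop

theorem conj_apply (f : Bosonic d k) (x : Config d k) :
    (conj f).1 x = (starRingEnd ℂ) (f.1 x) := rfl

theorem conj_conj (f : Bosonic d k) : conj (conj f) = f :=
  Subtype.ext (SchwartzMap.ext fun x => Complex.conj_conj (f.1 x))

theorem toDual_eq_l2Inner (f g : Bosonic d k) : toDual d k f g = l2Inner (conj g) f := by
  simp only [toDual_apply, l2Inner, conj_apply, Complex.conj_conj, mul_comm]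

theorem toDual_injective : Function.Injective (toDual d k) := fun f g h =>
  eq_of_forall_l2Inner fun u => by
    rw [← conj_conj u, ← toDual_eq_l2Inner, h, toDual_eq_l2Inner]

namespace Observable

/-- The linear map `𝔤_k → L(𝓢_s, 𝓢_s')` that induces the topology of `𝔤_k`. -/
def toCLM (d k : ℕ) : Observable d k →ₗ[ℝ] (Bosonic d k →L[ℂ] BosonicDual d k) where
  toFun A := (toDual d k).comp A.op
  map_add' A B := ContinuousLinearMap.comp_add _ A.op B.op
  map_smul' c A := ContinuousLinearMap.ext fun f => (toDual d k).map_smul_of_tower c (A.op f)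

theorem toCLM_apply (A : Observable d k) (f g : Bosonic d k) :
    toCLM d k A g f = matrixElement (conj f) g A := toDual_eq_l2Inner _ _

theorem toCLM_injective : Function.Injective (toCLM d k) := fun _ _ h =>
  ext_of_op fun f => toDual_injective (DFunLike.congr_fun h f)

theorem isInducing_toCLM : IsInducing (toCLM d k) := ⟨rfl⟩

instance : IsTopologicalAddGroup (Observable d k) := topologicalAddGroup_induced (toCLM d k)

instance : ContinuousSMul ℝ (Observable d k) :=
  have : ContinuousSMul ℝ (Bosonic d k →L[ℂ] BosonicDual d k) :=
    IsScalarTower.continuousSMul (M := ℝ) ℂ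
  continuousSMul_induced (toCLM d k)

instance : LocallyConvexSpace ℝ (Observable d k) := LocallyConvexSpace.induced (toCLM d k)

instance : T2Space (Observable d k) :=
  T2Space.of_injective_continuous toCLM_injective isInducing_toCLM.continuous

theorem tendsto_nhds_zero_iff {α : Type*} {u : Filter α} {A : α → Observable d k} :
    Tendsto A u (𝓝 0) ↔ ∀ S S' : Set (Bosonic d k), IsVonNBounded ℂ S → IsVonNBounded ℂ S' →
      TendstoUniformlyOn (fun a (p : Bosonic d k × Bosonic d k) => matrixElement p.1 p.2 (A a))
        0 u (S ×ˢ S') := by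
  have hbasis := ContinuousLinearMap.hasBasis_nhds_zero_of_basis (σ := RingHom.id ℂ)
    (E := Bosonic d k) (ContinuousLinearMap.hasBasis_nhds_zero_of_basis (σ := RingHom.id ℂ)
      (E := Bosonic d k) (Metric.nhds_basis_ball (x := (0 : ℂ))))
  rw [isInducing_toCLM.tendsto_nhds_iff, map_zero, hbasis.tendsto_right_iff]
  simp only [Metric.tendstoUniformlyOn_iff]
  constructor
  · intro h S S' hS hS' ε hε
    filter_upwards [h (S', conj '' S, ε) ⟨hS', hS.image conj, hε⟩] with a ha p hp
    have := ha p.2 hp.2 (conj p.1) ⟨p.1, hp.1, rfl⟩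
    rwa [Function.comp_apply, toCLM_apply, conj_conj, Metric.mem_ball, dist_comm] at this
  · rintro h ⟨S, S', ε⟩ ⟨hS, hS', hε⟩
    filter_upwards [h _ S (hS'.image conj) hS ε hε] with a ha g hg f hf
    rw [Function.comp_apply, toCLM_apply, Metric.mem_ball, dist_comm]
    exact ha (conj f, g) ⟨⟨f, hf, rfl⟩, hg⟩

theorem continuous_of_tendstoUniformlyOn (Ψ : Observable d k →ₗ[ℝ] Observable d m)
    (h : ∀ S S' : Set (Bosonic d m), IsVonNBounded ℂ S → IsVonNBounded ℂ S' →
      TendstoUniformlyOn (fun A (p : Bosonic d m × Bosonic d m) => matrixElement p.1 p.2 (Ψ A))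
        0 (𝓝 0) (S ×ˢ S')) : Continuous Ψ :=
  continuous_of_continuousAt_zero Ψ (by
    rw [ContinuousAt, map_zero]
    exact tendsto_nhds_zero_iff.2 h)

end Observable

theorem isVonNBounded_weighted_sliceMap (j : Fin k ↪ Fin N) {S : Set (Test d N)}
    (hS : IsVonNBounded ℂ S) (c : ℕ) :
    IsVonNBounded ℂ (Set.image2
      (fun (z : RestConfig d j) F => (((1 + ‖z‖) ^ c : ℝ) : ℂ) • sliceMap j z F) Set.univ S) := by
  convert isVonNBounded_weighted_sliceAt (hS.image
    (SchwartzMap.compCLMOfContinuousLinearEquiv ℂ (split j).symm)) c using 1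
  rw [Set.image2_image_right]
  rfl

theorem norm_l2Form_lift_le (j : Fin k ↪ Fin N) {r : ℕ}
    (hr : MeasureTheory.Integrable fun z : RestConfig d j => (1 + ‖z‖) ^ (-(r : ℝ)))
    (T : Test d k →L[ℂ] Test d k) (F G : Test d N) {δ : ℝ}
    (h : ∀ z, (1 + ‖z‖) ^ r * ‖l2Form (sliceMap j z F) (T (sliceMap j z G))‖ ≤ δ) :
    ‖l2Form F (lift j T G)‖ ≤ (∫ z : RestConfig d j, (1 + ‖z‖) ^ (-(r : ℝ))) * δ := by
  rw [l2Form_lift, ← MeasureTheory.integral_mul_const]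
  refine MeasureTheory.norm_integral_le_of_norm_le (hr.mul_const δ) (.of_forall fun z => ?_)
  have hz : 0 < 1 + ‖z‖ := by positivity
  rw [Real.rpow_neg hz.le, Real.rpow_natCast, ← div_eq_inv_mul, le_div_iff₀' (by positivity)]
  exact h z

theorem tendstoUniformlyOn_l2Form_lift (j : Fin k ↪ Fin N) {S S' : Set (Test d N)}
    (hS : IsVonNBounded ℂ S) (hS' : IsVonNBounded ℂ S') :
    TendstoUniformlyOn (fun (A : Observable d k) (p : Test d N × Test d N) =>
      l2Form p.1 (lift j A.extend p.2)) 0 (𝓝 0) (S ×ˢ S') := by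
  let μ : MeasureTheory.Measure (RestConfig d j) := MeasureTheory.volume
  have : μ.IsAddHaarMeasure := inferInstanceAs (MeasureTheory.Measure.pi fun _ =>
    (MeasureTheory.volume : MeasureTheory.Measure (EuclideanSpace ℝ (Fin d)))).IsAddHaarMeasure
  have hr := MeasureTheory.Measure.integrable_pow_neg_integrablePower μ
  set r := μ.integrablePower
  set I := ∫ z : RestConfig d j, (1 + ‖z‖) ^ (-(r : ℝ))
  have hI : 0 < I + 1 :=
    add_pos_of_nonneg_of_pos (MeasureTheory.integral_nonneg fun z => by positivity) one_pos
  rw [Metric.tendstoUniformlyOn_iff]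
  intro ε hε
  have hsmall := Metric.tendstoUniformlyOn_iff.1 (Observable.tendsto_nhds_zero_iff.1
    (tendsto_id (x := 𝓝 (0 : Observable d k))) _ _
    ((isVonNBounded_weighted_sliceMap j hS r).image (symmetrize d k))
    ((isVonNBounded_weighted_sliceMap j hS' 0).image (symmetrize d k))) (ε / (I + 1))
    (div_pos hε hI)
  filter_upwards [hsmall] with A hA p hp
  rw [Pi.zero_apply, dist_zero_left]
  refine (norm_l2Form_lift_le j hr A.extend p.1 p.2 (δ := ε / (I + 1)) fun z => ?_).trans_lt ?_
  · have := hA (_, _)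
      ⟨⟨_, ⟨z, trivial, p.1, hp.1, rfl⟩, rfl⟩, ⟨_, ⟨z, trivial, p.2, hp.2, rfl⟩, rfl⟩⟩
    simp only [id, ← Observable.l2Form_extend, pow_zero, Complex.ofReal_one, one_smul] at this
    rw [Pi.zero_apply, dist_zero_left, LinearMap.map_smulₛₗ₂, Complex.conj_ofReal, norm_smul,
      Complex.norm_real, Real.norm_of_nonneg (by positivity)] at this
    exact this.le
  · rw [mul_div_assoc', div_lt_iff₀ hI, mul_comm]
    gcongr
    exact lt_add_one I

theorem tendstoUniformlyOn_l2Form_comp_lift_comp (j : Fin k ↪ Fin N) {S S' : Set (Bosonic d N)}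
    (hS : IsVonNBounded ℂ S) (hS' : IsVonNBounded ℂ S') (T T' : Test d N →L[ℂ] Test d N) :
    TendstoUniformlyOn (fun (A : Observable d k) (p : Bosonic d N × Bosonic d N) =>
      l2Form (T p.1.1) (lift j A.extend (T' p.2.1))) 0 (𝓝 0) (S ×ˢ S') := by
  have h := (tendstoUniformlyOn_l2Form_lift j
    (hS.image (T ∘L (bosonic d N).subtypeL)) (hS'.image (T' ∘L (bosonic d N).subtypeL))).comp
      (Prod.map (T ∘L (bosonic d N).subtypeL) (T' ∘L (bosonic d N).subtypeL))
  exact h.mono fun p hp => ⟨⟨p.1, hp.1, rfl⟩, ⟨p.2, hp.2, rfl⟩⟩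

theorem continuous_embed (hkN : k ≤ N) :
    Continuous (embed N : Observable d k → Observable d N) := by
  refine Observable.continuous_of_tendstoUniformlyOn (embedₗ hkN) fun S S' hS hS' => ?_
  exact (tendstoUniformlyOn_l2Form_comp_lift_comp (Fin.castLEEmb hkN) hS hS' (.id ℂ _)
    (.id ℂ _)).congr (.of_forall fun A p _ => (matrixElement_embed _ A p.1 p.2).symm)

/-- The commutator `[A_i, B_j]` as a linear map in `A`. -/
def pairCommₗ (i : Fin k ↪ Fin N) (j : Fin l ↪ Fin N) (B : Observable d l) :
    Observable d k →ₗ[ℝ] Observable d N where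
  toFun A := pairComm i j A B
  map_add' A A' := Observable.ext_of_matrixElement fun f g => by
    have h (F : Test d N) : lift i (A + A').extend F = lift i A.extend F + lift i A'.extend F := rfl
    simp only [map_add, matrixElement_pairComm, h]
    ring
  map_smul' c A := Observable.ext_of_matrixElement fun f g => by
    have h (F : Test d N) : lift i (c • A).extend F = (c : ℂ) • lift i A.extend F := rfl
    simp only [map_smul, matrixElement_pairComm, h, RingHom.id_apply, Complex.real_smul,
      smul_eq_mul]
    ring

theorem continuous_pairComm_left (i : Fin k ↪ Fin N) (j : Fin l ↪ Fin N) (B : Observable d l) :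
    Continuous fun A : Observable d k => pairComm i j A B := by
  refine Observable.continuous_of_tendstoUniformlyOn (pairCommₗ i j B) fun S S' hS hS' => ?_
  have h := (tendstoUniformlyOn_l2Form_comp_lift_comp i hS hS' (.id ℂ _) (lift j B.extend)).add
    (tendstoUniformlyOn_l2Form_comp_lift_comp i hS hS' (lift j B.extend) (.id ℂ _))
  rw [add_zero] at h
  refine h.congr (.of_forall fun A p _ => Eq.trans ?_ (matrixElement_pairComm i j A B _ _).symm)
  rw [sub_eq_add_neg, ← B.isSkew_extend.lift j]
  rfl

end Topology

section LieAlgebra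

variable {d k l m N : ℕ}

theorem exists_lie_embed_embed_eq_embed (hk : k ≤ N) (hl : l ≤ N) (hm : min (k + l - 1) N ≤ m)
    (hmN : m ≤ N) (B : Observable d l) : ∃ C : Observable d k →L[ℝ] Observable d m,
      ∀ A, (embed N A).lie (embed N B) = embed N (C A) := by
  have hpair (i : Fin k ↪ Fin N) (j : Fin l ↪ Fin N) :
      ∃ C : Observable d k →L[ℝ] Observable d m, ∀ A, pairComm i j A B = embed N (C A) := by
    by_cases hij : Disjoint (Set.range i) (Set.range j)
    · exact ⟨0, fun A => (pairComm_of_disjoint hij A B).trans (map_zero (embedₗ hmN)).symm⟩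
    · obtain ⟨e, a, b, rfl, rfl⟩ := exists_common_extension hm hmN hij
      exact ⟨⟨pairCommₗ a b B, continuous_pairComm_left a b B⟩,
        fun A => (embed_pairComm e a b A B).symm⟩
  choose C hC using hpair
  refine ⟨((N : ℝ) * ((k.factorial * N.choose k : ℕ) : ℝ)⁻¹ *
    ((l.factorial * N.choose l : ℕ) : ℝ)⁻¹) • ∑ i, ∑ j, C i j, fun A => ?_⟩
  simp only [lie_embed_embed_eq_sum hk hl, hC, smul_apply, sum_apply, embed_smul hmN,
    embed_sum hmN]

namespace Observable

theorem lie_swap (A B : Observable d N) : A.lie B = -B.lie A := ext_of_op fun f => by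
  change _ = -((B.lie A).op f)
  rw [lie_op, lie_op, ← smul_neg, neg_sub]

/-- The bracket of `𝔤_N` as a linear map in its second entry. -/
def lieₗ (A : Observable d N) : Observable d N →ₗ[ℝ] Observable d N where
  toFun := A.lie
  map_add' B B' := ext_of_op fun f => by
    change _ = (A.lie B).op f + (A.lie B').op f
    have h (u : Bosonic d N) : (B + B').op u = B.op u + B'.op u := rfl
    simp only [lie_op, h, map_add, ← smul_add]
    congr 1
    abel
  map_smul' c B := ext_of_op fun f => by
    change _ = c • (A.lie B).op f
    have h (u : Bosonic d N) : (c • B).op u = c • B.op u := rfl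
    simp only [lie_op, h, A.op.map_smul_of_tower, ← smul_sub, smul_comm c]

theorem lie_jacobi (A B C : Observable d N) :
    A.lie (B.lie C) + C.lie (A.lie B) + B.lie (C.lie A) = 0 := ext_of_op fun f => by
  change (A.lie (B.lie C)).op f + (C.lie (A.lie B)).op f + (B.lie (C.lie A)).op f = 0
  simp only [lie_op, map_sub, A.op.map_smul_of_tower, B.op.map_smul_of_tower,
    C.op.map_smul_of_tower, ← smul_sub, ← smul_add]
  convert! smul_zero (N : ℝ)
  convert! smul_zero (N : ℝ)
  abel

end Observable

/-- The component of `𝔊_N` to which the brackets of the components `a` and `b` belong. -/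
def bracketDegree (a b : ↥(Finset.Icc 1 N)) : ↥(Finset.Icc 1 N) :=
  ⟨min (a + b - 1) N, by
    have := Finset.mem_Icc.1 a.2
    have := Finset.mem_Icc.1 b.2
    exact Finset.mem_Icc.2 (by omega)⟩

theorem bracketDegree_comm (a b : ↥(Finset.Icc 1 N)) : bracketDegree a b = bracketDegree b a := by
  simp only [bracketDegree, add_comm]

theorem bracketDegree_rotate (a b c : ↥(Finset.Icc 1 N)) :
    bracketDegree c (bracketDegree a b) = bracketDegree a (bracketDegree b c) := by
  have := Finset.mem_Icc.1 a.2
  have := Finset.mem_Icc.1 b.2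
  have := Finset.mem_Icc.1 c.2
  apply Subtype.ext
  simp only [bracketDegree]
  omega

theorem embed_bracket (A B : Hier d N) (k : ↥(Finset.Icc 1 N)) :
    embed N (bracket A B k) = ∑ a, ∑ b,
      if bracketDegree a b = k then (embed N (A a)).lie (embed N (B b)) else 0 := by
  rw [bracket, embed_sum (Finset.mem_Icc.1 k.2).2, ← Fintype.sum_prod_type', Finset.sum_filter]
  refine Finset.sum_congr rfl fun p _ => ?_
  by_cases h : bracketDegree p.1 p.2 = k
  · obtain ⟨C, hC⟩ := exists_lie_embed_embed_eq_embed (Finset.mem_Icc.1 p.1.2).2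
      (Finset.mem_Icc.1 p.2.2).2 (congrArg Subtype.val h).le (Finset.mem_Icc.1 k.2).2 (B p.2)
    rw [if_pos h, if_pos (show min (p.1.1 + p.2.1 - 1) N = k from congrArg Subtype.val h)]
    exact Function.invFun_eq ⟨C (A p.1), (hC _).symm⟩
  · rw [if_neg h, if_neg fun h' : min (p.1.1 + p.2.1 - 1) N = k => h (Subtype.ext h')]

theorem hier_ext {A B : Hier d N} (h : ∀ k, embed N (A k) = embed N (B k)) : A = B :=
  funext fun k => embed_injective (Finset.mem_Icc.1 k.2).1 (Finset.mem_Icc.1 k.2).2 (h k)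

theorem bracket_swap (A B : Hier d N) : bracket A B = -bracket B A := hier_ext fun k => by
  have hneg : embed N (-bracket B A k) = -embed N (bracket B A k) :=
    map_neg (embedₗ (Finset.mem_Icc.1 k.2).2) _
  rw [Pi.neg_apply, hneg, embed_bracket, embed_bracket, Finset.sum_comm]
  simp only [← Finset.sum_neg_distrib]
  refine Finset.sum_congr rfl fun b _ => Finset.sum_congr rfl fun a _ => ?_
  rw [bracketDegree_comm, Observable.lie_swap]
  split_ifs
  exacts [rfl, neg_zero.symm]

theorem bracket_add_right (A B B' : Hier d N) :
    bracket A (B + B') = bracket A B + bracket A B' := hier_ext fun k => by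
  have h (A B B' : Observable d N) : A.lie (B + B') = A.lie B + A.lie B' := map_add A.lieₗ B B'
  simp only [Pi.add_apply, embed_add (Finset.mem_Icc.1 (Subtype.prop _)).2, embed_bracket, h,
    ← Finset.sum_add_distrib, ite_add_ite, add_zero]

theorem bracket_smul_right (c : ℝ) (A B : Hier d N) :
    bracket A (c • B) = c • bracket A B := hier_ext fun k => by
  have h (A B : Observable d N) : A.lie (c • B) = c • A.lie B := map_smul A.lieₗ c B
  simp only [Pi.smul_apply, embed_smul (Finset.mem_Icc.1 (Subtype.prop _)).2, embed_bracket, h,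
    Finset.smul_sum, smul_ite, smul_zero]

theorem embed_bracket_bracket (A B C : Hier d N) (k : ↥(Finset.Icc 1 N)) :
    embed N (bracket A (bracket B C) k) = ∑ a, ∑ b, ∑ c,
      if bracketDegree a (bracketDegree b c) = k then
        (embed N (A a)).lie ((embed N (B b)).lie (embed N (C c))) else 0 := by
  have hsum {ι : Type} [Fintype ι] (A : Observable d N) (B : ι → Observable d N) :
      A.lie (∑ i, B i) = ∑ i, A.lie (B i) := map_sum A.lieₗ B _
  have hzero (A : Observable d N) : A.lie 0 = 0 := map_zero A.lieₗ
  rw [embed_bracket]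
  refine Finset.sum_congr rfl fun a _ => ?_
  simp only [embed_bracket, hsum, apply_ite (Observable.lie _), hzero]
  calc ∑ e, (if bracketDegree a e = k then ∑ b, ∑ c, if bracketDegree b c = e then
          (embed N (A a)).lie ((embed N (B b)).lie (embed N (C c))) else 0 else 0)
      = ∑ e, ∑ b, ∑ c, if bracketDegree b c = e then if bracketDegree a e = k then
          (embed N (A a)).lie ((embed N (B b)).lie (embed N (C c))) else 0 else 0 := by
        refine Finset.sum_congr rfl fun e _ => ?_
        split_ifs <;> simp
    _ = _ := by
        rw [Finset.sum_comm]
        refine Finset.sum_congr rfl fun b _ => ?_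
        rw [Finset.sum_comm]
        simp only [Finset.sum_ite_eq, Finset.mem_univ, if_true]

theorem sum_rotate {X M : Type*} [Fintype X] [AddCommMonoid M] (f : X → X → X → M) :
    ∑ c, ∑ a, ∑ b, f c a b = ∑ a, ∑ b, ∑ c, f c a b := by
  rw [Finset.sum_comm]
  exact Finset.sum_congr rfl fun a _ => Finset.sum_comm

theorem bracket_jacobi (A B C : Hier d N) :
    bracket A (bracket B C) + bracket C (bracket A B) + bracket B (bracket C A) = 0 :=
  hier_ext fun k => by
    have hkN := (Finset.mem_Icc.1 k.2).2
    have hzero : embed N (0 : Observable d k) = 0 := map_zero (embedₗ hkN)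
    rw [Pi.add_apply, Pi.add_apply, Pi.zero_apply, embed_add hkN, embed_add hkN, hzero,
      embed_bracket_bracket A, embed_bracket_bracket C, embed_bracket_bracket B,
      sum_rotate fun c a b => ite (bracketDegree c (bracketDegree a b) = k) _ _,
      ← sum_rotate fun a b c => ite (bracketDegree b (bracketDegree c a) = k) _ _]
    simp only [← Finset.sum_add_distrib]
    refine Finset.sum_eq_zero fun a _ => Finset.sum_eq_zero fun b _ =>
      Finset.sum_eq_zero fun c _ => ?_
    rw [bracketDegree_rotate a b c, ← bracketDegree_rotate b c a]
    split_ifs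
    · exact Observable.lie_jacobi _ _ _
    · simp only [add_zero]

theorem continuous_bracket_left (B : Hier d N) : Continuous fun A : Hier d N => bracket A B := by
  refine continuous_pi fun k => continuous_finsetSum _ fun p hp => ?_
  have hk := Finset.mem_Icc.1 k.2
  obtain ⟨C, hC⟩ := exists_lie_embed_embed_eq_embed (Finset.mem_Icc.1 p.1.2).2
    (Finset.mem_Icc.1 p.2.2).2 (Finset.mem_filter.1 hp).2.le hk.2 (B p.2)
  simp only [hC, Function.leftInverse_invFun (embed_injective hk.1 hk.2) _]
  exact C.continuous.comp (continuous_apply p.1)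

theorem isLieAlgebra_hier (d N : ℕ) : IsLieAlgebra (Hier d N) bracket where
  isTopologicalAddGroup := inferInstance
  continuousSMul := inferInstance
  locallyConvex := inferInstance
  hausdorff := inferInstance
  continuous_left := continuous_bracket_left
  continuous_right A := by
    simp only [bracket_swap A]
    exact (continuous_bracket_left A).neg
  add_left A A' B := by
    rw [bracket_swap, bracket_add_right, neg_add, ← bracket_swap, ← bracket_swap]
  add_right := bracket_add_right
  smul_left c A B := by
    rw [bracket_swap, bracket_smul_right, ← smul_neg, ← bracket_swap]
  smul_right := bracket_smul_right
  self A := by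
    have h := bracket_swap A A
    rwa [eq_neg_iff_add_eq_zero, ← two_smul ℝ, smul_eq_zero_iff_right two_ne_zero] at h
  jacobi := bracket_jacobi

end LieAlgebra

end Hierarchy

end

theorem proposition2p1 (d N : ℕ) (hd : 1 ≤ d) (hN : 1 ≤ N) :
    (∀ k : ℕ, 1 ≤ k → k ≤ N →
      (∀ A : Hierarchy.Observable d k, Hierarchy.IsEmbedded A (Hierarchy.embed N A)) ∧
      IsLinearMap ℝ
        (Hierarchy.embed N : Hierarchy.Observable d k → Hierarchy.Observable d N) ∧
      Continuous
        (Hierarchy.embed N : Hierarchy.Observable d k → Hierarchy.Observable d N) ∧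
      Function.Injective
        (Hierarchy.embed N : Hierarchy.Observable d k → Hierarchy.Observable d N)) ∧
    (∀ l j : ℕ, 1 ≤ l → l ≤ N → 1 ≤ j → j ≤ N →
      ∀ (A : Hierarchy.Observable d l) (B : Hierarchy.Observable d j),
        ∃ C : Hierarchy.Observable d (min (l + j - 1) N),
          Hierarchy.Observable.lie (Hierarchy.embed N A) (Hierarchy.embed N B) =
            Hierarchy.embed N C) ∧
    Hierarchy.IsLieAlgebra (Hierarchy.Hier d N) Hierarchy.bracket :=
  ⟨fun _ hk hkN =>
    ⟨Hierarchy.isEmbedded_embed hkN, (Hierarchy.embedₗ hkN).isLinear,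
      Hierarchy.continuous_embed hkN, Hierarchy.embed_injective hk hkN⟩,
    fun _ _ _ hl _ hj A B =>
      let ⟨C, hC⟩ := Hierarchy.exists_lie_embed_embed_eq_embed hl hj le_rfl (min_le_right _ _) B
      ⟨C A, hC A⟩,
    Hierarchy.isLieAlgebra_hier d N⟩
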